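/- Let $G=(V,E)$ be an undirected graph on $n=|V|$ vertices with non-negative real edge capacities $w(e)$, and let $S\subseteq V$ be a Steiner set, $|S|\ge 2$. For $C\subseteq V$, the capacity $c(C)$ is the sum of the capacities of the edges with exactly one endpoint in $C$; $C$ is a Steiner cut if $s\in C$, $s'\notin C$ for some $s,s'\in S$. An $S$-mincut is a Steiner cut of least capacity; its capacity is denoted by $\lambda_S$. Computation takes place on a random access machine at unit cost. Vertices are named $0,\dots,n-1$. Memory cells hold either a word of $O(\log n)$ bits, with the usual word operations (arithmetic, bitwise operations, shifts, comparisons), or a real number, which can only be copied, added, subtracted and compared. A data structure is a read-only finite memory, and its space is its number of cells; each of its real cells holds $c(C)$ for some $C\subseteq V$. A query consists of the two endpoints of an edge $e=(x,y)\in E$ and a real $\Delta$ with $0\le\Delta\le w(e)$. Queries are answered by a fixed finite program using finitely many registers. The programs and all the constants hidden in $O(\cdot)$ (including the one in the word size) are independent of $n$, $G$, $S$ and the query. Then the following hold. 1. There is an $O(n)$-space data structure which stores, as linked records, a rooted full binary tree $\mathcal T(G)$ with $O(n)$ nodes, whose internal nodes $\mu$ carry real numbers $\mu.\mathrm{cap}$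 and to whose leaves the vertices of $G$ are mapped, and which, given any edge $e=(x,y)\in E$ and any $\Delta$ with $0\le \Delta\le w(e)$, reports in $O(1)$ time the capacity of an $S$-mincut after the capacity of $e$ is reduced by $\Delta$. Moreover, $x$ and $y$ are mapped to different leaves, and this capacity equals $\min(\lambda_S,\ \mu.\mathrm{cap}-\Delta)$, where $\mu$ is the lowest common ancestor of these two leaves in $\mathcal T(G)$. 2. There is an $O(n(n-|S|+1))$-space data structure $\mathcal F(G)$ which, given any edge $e=(x,y)\in E$ and any $\Delta$ with $0\le \Delta\le w(e)$, reports in $O(|C|)$ time an $S$-mincut $C$ of the graph after the capacity of $e$ is reduced by $\Delta$, by listing each vertex of $C$ exactly once. -/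

import Mathlib

/-! ## Undirected weighted graphs, Steiner cuts and Steiner mincuts -/

/-- An undirected graph on the `n` vertices `0, …, n - 1` whose edges carry non-negative real
capacities. Values of `w` outside the edge set are irrelevant. -/
structure WGraph (n : ℕ) where
  graph : SimpleGraph (Fin n)
  w : Sym2 (Fin n) → ℝ
  w_nonneg : ∀ e ∈ graph.edgeSet, 0 ≤ w e

/-- The edge (or pair) `e` contributes to `C`: exactly one of its endpoints lies in `C`. -/
def Contributes {n : ℕ} (e : Sym2 (Fin n)) (C : Finset (Fin n)) : Prop :=
  ∃ u v : Fin n, e = s(u, v) ∧ u ∈ C ∧ v ∉ C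

/-- A set `C` of vertices is a Steiner cut if it splits the Steiner set `S`
(it is then nonempty and proper). -/
def IsSteinerCut {n : ℕ} (S C : Finset (Fin n)) : Prop :=
  ∃ s ∈ S, ∃ s' ∈ S, s ∈ C ∧ s' ∉ C

namespace WGraph

open Classical in
/-- The capacity `c(C)`: the sum of the capacities of all edges contributing to `C`. -/
noncomputable def cap {n : ℕ} (G : WGraph n) (C : Finset (Fin n)) : ℝ :=
  ∑ e ∈ Finset.univ.filter (fun e : Sym2 (Fin n) => e ∈ G.graph.edgeSet ∧ Contributes e C), G.w e

/-- `C` is a Steiner mincut (an `S`-mincut): a Steiner cut of the least capacity. -/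
def IsSteinerMincut {n : ℕ} (G : WGraph n) (S C : Finset (Fin n)) : Prop :=
  IsSteinerCut S C ∧ ∀ C' : Finset (Fin n), IsSteinerCut S C' → G.cap C ≤ G.cap C'

/-- The capacity `λ_S` of an `S`-mincut. -/
noncomputable def steinerCap {n : ℕ} (G : WGraph n) (S : Finset (Fin n)) : ℝ :=
  sInf {r : ℝ | ∃ C : Finset (Fin n), IsSteinerCut S C ∧ G.cap C = r}

/-- For a Steiner set with at least two vertices an `S`-mincut exists. -/
theorem exists_isSteinerMincut {n : ℕ} (G : WGraph n) (S : Finset (Fin n)) (hS : 2 ≤ S.card) :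
    ∃ C : Finset (Fin n), G.IsSteinerMincut S C := by
  classical
  obtain ⟨a, ha, b, hb, hab⟩ := Finset.one_lt_card.mp hS
  have hne : (Finset.univ.filter (fun C : Finset (Fin n) => IsSteinerCut S C)).Nonempty :=
    ⟨{a}, Finset.mem_filter.mpr ⟨Finset.mem_univ _, a, ha, b, hb, Finset.mem_singleton_self a,
      fun h => hab (Finset.mem_singleton.mp h).symm⟩⟩
  obtain ⟨C, hC, hmin⟩ := Finset.exists_min_image _ G.cap hne
  exact ⟨C, (Finset.mem_filter.mp hC).2, fun C' hC' => hmin C' (by simpa using hC')⟩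

/-- `steinerCap` is the capacity of every `S`-mincut. -/
theorem IsSteinerMincut.cap_eq {n : ℕ} {G : WGraph n} {S C : Finset (Fin n)}
    (h : G.IsSteinerMincut S C) : G.cap C = G.steinerCap S := by
  have hl : IsLeast {r : ℝ | ∃ C : Finset (Fin n), IsSteinerCut S C ∧ G.cap C = r} (G.cap C) := by
    refine ⟨⟨C, h.1, rfl⟩, ?_⟩
    rintro r ⟨C', hC', rfl⟩
    exact h.2 C' hC'
  exact hl.csInf_eq.symm

/-- The graph obtained from `G` by reducing the capacity of `e` by `Δ ≤ w(e)`. -/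
noncomputable def reduce {n : ℕ} (G : WGraph n) (e : Sym2 (Fin n)) (Δ : ℝ) (h : Δ ≤ G.w e) :
    WGraph n where
  graph := G.graph
  w := Function.update G.w e (G.w e - Δ)
  w_nonneg := by
    intro e' he'
    by_cases hee : e' = e
    · subst hee
      simpa using h
    · simpa [hee] using G.w_nonneg e' he'

end WGraph

/-! ## The machine: a random access machine with `b`-bit words and real cells

Integers are confined to words of `b` bits with the usual unit-cost word operations. Real numbers
live in separate cells; they can only be copied, added, subtracted and compared. The data structure
is read-only at query time, and apart from it the machine has the finitely many registers that its
(fixed, finite) program mentions. -/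

/-- The unit-cost word operations. -/
inductive WordOp
  | add | sub | mul | div | mod | and | or | xor | shl | shr

/-- The value of a word operation; every result is reduced modulo `2 ^ b`. -/
def WordOp.eval (b : ℕ) : WordOp → ℕ → ℕ → ℕ
  | .add, x, y => (x + y) % 2 ^ b
  | .sub, x, y => (x + (2 ^ b - y)) % 2 ^ b
  | .mul, x, y => (x * y) % 2 ^ b
  | .div, x, y => (x / y) % 2 ^ b
  | .mod, x, y => (x % y) % 2 ^ b
  | .and, x, y => (Nat.land x y) % 2 ^ b
  | .or, x, y => (Nat.lor x y) % 2 ^ b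
  | .xor, x, y => (Nat.xor x y) % 2 ^ b
  | .shl, x, y => (x <<< y) % 2 ^ b
  | .shr, x, y => (x >>> y) % 2 ^ b

/-- Instructions. Registers, constants and jump targets are fixed natural numbers; `d` is a
destination register. Memory is only reached through addresses held in word registers. -/
inductive Instr
  | const (d k : ℕ)
  | move (d a : ℕ)
  | op (o : WordOp) (d a a' : ℕ)
  | load (d a : ℕ)
  | rmove (d a : ℕ)
  | radd (d a a' : ℕ)
  | rsub (d a a' : ℕ)
  | rload (d a : ℕ)
  | jump (t : ℕ)
  | jumpEq (a a' t : ℕ)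
  | jumpLt (a a' t : ℕ)
  | rjumpLt (a a' t : ℕ)
  | emit (a : ℕ)
  | remit (a : ℕ)

/-- The memory image of a data structure: word cells and real cells. -/
structure DataStruct where
  words : List ℕ
  reals : List ℝ

/-- The space occupied by a data structure: its number of memory cells. -/
def DataStruct.space (D : DataStruct) : ℕ := D.words.length + D.reals.length

/-- `D` is a legitimate data structure for `G` with `b`-bit words: every word cell holds a `b`-bit
number, and every real cell holds the capacity of some set of vertices of `G` (so that no
information is hidden in the digits of an artificial real number). -/
def DataStruct.ValidFor {n : ℕ} (D : DataStruct) (G : WGraph n) (b : ℕ) : Prop :=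
  (∀ v ∈ D.words, v < 2 ^ b) ∧ ∀ r ∈ D.reals, ∃ C : Finset (Fin n), r = G.cap C

/-- Machine configurations: program counter, word and real registers, and the words and reals
written to the output so far. -/
structure Config where
  pc : ℕ
  wreg : ℕ → ℕ
  rreg : ℕ → ℝ
  outW : List ℕ
  outR : List ℝ

/-- The effect of one instruction. A read outside the memory yields `0`. -/
noncomputable def Instr.exec (D : DataStruct) (b : ℕ) (c : Config) : Instr → Config
  | .const d k => { c with pc := c.pc + 1, wreg := Function.update c.wreg d (k % 2 ^ b) }
  | .move d a => { c with pc := c.pc + 1, wreg := Function.update c.wreg d (c.wreg a) }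
  | .op o d a a' =>
      { c with pc := c.pc + 1, wreg := Function.update c.wreg d (o.eval b (c.wreg a) (c.wreg a')) }
  | .load d a =>
      { c with pc := c.pc + 1, wreg := Function.update c.wreg d (D.words.getD (c.wreg a) 0) }
  | .rmove d a => { c with pc := c.pc + 1, rreg := Function.update c.rreg d (c.rreg a) }
  | .radd d a a' =>
      { c with pc := c.pc + 1, rreg := Function.update c.rreg d (c.rreg a + c.rreg a') }
  | .rsub d a a' =>
      { c with pc := c.pc + 1, rreg := Function.update c.rreg d (c.rreg a - c.rreg a') }
  | .rload d a =>
      { c with pc := c.pc + 1, rreg := Function.update c.rreg d (D.reals.getD (c.wreg a) 0) }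
  | .jump t => { c with pc := t }
  | .jumpEq a a' t => { c with pc := if c.wreg a = c.wreg a' then t else c.pc + 1 }
  | .jumpLt a a' t => { c with pc := if c.wreg a < c.wreg a' then t else c.pc + 1 }
  | .rjumpLt a a' t => { c with pc := if c.rreg a < c.rreg a' then t else c.pc + 1 }
  | .emit a => { c with pc := c.pc + 1, outW := c.outW ++ [c.wreg a] }
  | .remit a => { c with pc := c.pc + 1, outR := c.outR ++ [c.rreg a] }

/-- One step of the program `P`; the machine has halted once the program counter has left `P`. -/
noncomputable def step (P : List Instr) (D : DataStruct) (b : ℕ) (c : Config) : Config :=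
  match P[c.pc]? with
  | none => c
  | some i => i.exec D b c

/-- The initial configuration for a query: the endpoints `x`, `y` of the edge in the word registers
`0` and `1`, the value `Δ` in the real register `0`, and zero in all other registers. -/
noncomputable def initConfig {n : ℕ} (b : ℕ) (x y : Fin n) (Δ : ℝ) : Config where
  pc := 0
  wreg := fun i => if i = 0 then x.val % 2 ^ b else if i = 1 then y.val % 2 ^ b else 0
  rreg := fun i => if i = 0 then Δ else 0
  outW := []
  outR := []

/-- On the data structure `D` and the query `(x, y), Δ`, the program `P` halts after at most `T`
steps, having written exactly the words `outW` and the reals `outR`. -/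
def Answers {n : ℕ} (P : List Instr) (D : DataStruct) (b : ℕ) (x y : Fin n) (Δ : ℝ) (T : ℕ)
    (outW : List ℕ) (outR : List ℝ) : Prop :=
  ∃ t ≤ T, ∃ c : Config, c = (step P D b)^[t] (initConfig b x y Δ) ∧
    P.length ≤ c.pc ∧ c.outW = outW ∧ c.outR = outR

/-! ## Rooted capacity trees -/

/-- A rooted (full binary) tree whose internal nodes carry a capacity and whose leaves carry the
set of vertices mapped to them. -/
inductive CapTree (n : ℕ)
  | leaf (U : Finset (Fin n))
  | node (cap : ℝ) (left right : CapTree n)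

namespace CapTree

/-- The number of nodes. -/
def numNodes {n : ℕ} : CapTree n → ℕ
  | leaf _ => 1
  | node _ l r => l.numNodes + r.numNodes + 1

/-- The set of vertices mapped to the leaves of the tree. -/
def verts {n : ℕ} : CapTree n → Finset (Fin n)
  | leaf U => U
  | node _ l r => l.verts ∪ r.verts

/-- No vertex is mapped to two different leaves. -/
def DisjointLeaves {n : ℕ} : CapTree n → Prop
  | leaf _ => True
  | node _ l r => Disjoint l.verts r.verts ∧ l.DisjointLeaves ∧ r.DisjointLeaves

/-- The capacity at the lowest common ancestor of the leaves of `x` and `y`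
(`none` if `x` and `y` are mapped to the same leaf). -/
def lcaCap {n : ℕ} : CapTree n → Fin n → Fin n → Option ℝ
  | leaf _, _, _ => none
  | node c l r, x, y =>
      if x ∈ l.verts ∧ y ∈ l.verts then l.lcaCap x y
      else if x ∈ r.verts ∧ y ∈ r.verts then r.lcaCap x y
      else some c

/-- `D` stores the tree as linked records, with the root record at address `a` and, at address
`base + u`, a pointer to the leaf of the vertex `u`. A leaf is a record `0`; an internal node is a
record `1, i, p, q`, where `i` is the real cell holding its capacity and `p`, `q` are the addresses
of its left and right child. -/
def StoredAt {n : ℕ} (D : DataStruct) (base : ℕ) : CapTree n → ℕ → Prop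
  | leaf U, a => D.words[a]? = some 0 ∧ ∀ u ∈ U, D.words[base + u.val]? = some a
  | node c l r, a => D.words[a]? = some 1 ∧ ∃ i p q : ℕ,
      D.words[a + 1]? = some i ∧ D.reals[i]? = some c ∧
      D.words[a + 2]? = some p ∧ l.StoredAt D base p ∧
      D.words[a + 3]? = some q ∧ r.StoredAt D base q

/-- `D` stores the tree: word cell `0` points to its root and word cell `1` to the array of leaf
pointers. The remaining cells of `D` are free for auxiliary information. -/
def StoredIn {n : ℕ} (T : CapTree n) (D : DataStruct) : Prop :=
  ∃ root base : ℕ, D.words[0]? = some root ∧ D.words[1]? = some base ∧ T.StoredAt D base root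

end CapTree

/-! ## Cut functions -/

/-! Lowering the capacity of (x,y) by Δ lowers exactly the cuts separating x and y, each by Δ. Hence
the new value is min(λ_S, c(C) - Δ), where C is a least ("best") Steiner cut separating x and y, and
either C or an old S-mincut attains it (`WGraph.reduce_steinerCap`).

One binary tree supplies all best cuts (`CutTree.exists_optimal`): take a least Steiner cut of the
graph splitting the current vertex set, divide the set along it, and recurse down to singletons. A
cut separating x and y splits the set at the lowest common ancestor of their leaves, so the cut
stored there is best for them.

To reach it in constant time, the cuts are read in symmetric order as the gaps between consecutive
leaves. The cut at a node is no larger than any cut below it, so a minimum over the gaps between two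
leaves replaces the common ancestor (`CutTree.Optimal.isBest_of_min`). The range minimum over ranks
is found with tables of O(n) words: blocks of logarithmic length, sparse tables over blocks, and a
bit mask for queries inside a block.

Ties would spoil this, as a minimal gap might carry a cut not separating x and y. Cuts are therefore
compared by c + ε·(star cut with edge capacities 2^v) for small ε > 0. This refines the order of
capacities and leaves ties only between a set and its complement (`WGraph.exists_isGenericCut`).

For listing cuts, a node with Steiner vertices below both children carries a best cut of a Steiner
pair. By uncrossing, such cuts, complemented to avoid a fixed vertex, are laminar
(`IsBest.laminar`), so all are segments of a single list of the n vertices. At most n - |S| cuts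
remain (`CutTree.Optimal.countP_not_isBest`); these and one S-mincut are written out in full.
Complementing is harmless, since the complement of an S-mincut is one too. -/

theorem contributes_mk {n : ℕ} (u v : Fin n) (C : Finset (Fin n)) :
    Contributes s(u, v) C ↔ ¬ (u ∈ C ↔ v ∈ C) := by
  constructor
  · rintro ⟨a, b, h, ha, hb⟩
    rcases Sym2.eq_iff.mp h with ⟨rfl, rfl⟩ | ⟨rfl, rfl⟩ <;> tauto
  · intro h
    by_cases hu : u ∈ C
    · exact ⟨u, v, rfl, hu, by tauto⟩
    · exact ⟨v, u, Sym2.eq_swap, by tauto, hu⟩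

/-- A symmetric submodular function which takes equal values only on equal or complementary
sets. -/
structure IsGenericCut {n : ℕ} (h : Finset (Fin n) → ℝ) : Prop where
  compl : ∀ A, h Aᶜ = h A
  submod : ∀ A B, h (A ∩ B) + h (A ∪ B) ≤ h A + h B
  inj : ∀ A B, h A = h B → A = B ∨ A = Bᶜ

/-- Submodularity for A and Bᶜ, rewritten by symmetry under complement. -/
theorem IsGenericCut.posimod {n : ℕ} {h : Finset (Fin n) → ℝ} (H : IsGenericCut h)
    (A B : Finset (Fin n)) : h (A \ B) + h (B \ A) ≤ h A + h B := by
  have h1 := H.submod A Bᶜ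
  rw [H.compl, ← H.compl (A ∪ Bᶜ)] at h1
  have e1 : A ∩ Bᶜ = A \ B := by ext; simp
  have e2 : (A ∪ Bᶜ)ᶜ = B \ A := by ext; simp [and_comm]
  rwa [e1, e2] at h1

namespace WGraph

open Classical in
theorem cap_eq_sum {n : ℕ} (G : WGraph n) (C : Finset (Fin n)) :
    G.cap C = ∑ e ∈ Finset.univ.filter (fun e : Sym2 (Fin n) => e ∈ G.graph.edgeSet),
      if Contributes e C then G.w e else 0 := by
  rw [cap, ← Finset.sum_filter, Finset.filter_filter]

theorem cap_compl {n : ℕ} (G : WGraph n) (C : Finset (Fin n)) : G.cap Cᶜ = G.cap C := by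
  classical
  rw [cap_eq_sum, cap_eq_sum]
  refine Finset.sum_congr rfl fun e _ => ?_
  induction e with
  | _ u v =>
    have : Contributes s(u, v) Cᶜ ↔ Contributes s(u, v) C := by
      simp only [contributes_mk, Finset.mem_compl]; tauto
    simp only [this]

theorem cap_submod {n : ℕ} (G : WGraph n) (A B : Finset (Fin n)) :
    G.cap (A ∩ B) + G.cap (A ∪ B) ≤ G.cap A + G.cap B := by
  classical
  simp only [cap_eq_sum, ← Finset.sum_add_distrib]
  refine Finset.sum_le_sum fun e he => ?_
  have hw := G.w_nonneg e (by simpa using he)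
  induction e with
  | _ u v =>
    simp only [contributes_mk, Finset.mem_inter, Finset.mem_union]
    by_cases h1 : u ∈ A <;> by_cases h2 : u ∈ B <;> by_cases h3 : v ∈ A <;>
      by_cases h4 : v ∈ B <;> simp [h1, h2, h3, h4, hw]

open Classical in
theorem reduce_cap {n : ℕ} (G : WGraph n) {x y : Fin n} (hxy : G.graph.Adj x y) (Δ : ℝ)
    (hΔ : Δ ≤ G.w s(x, y)) (C : Finset (Fin n)) :
    (G.reduce s(x, y) Δ hΔ).cap C = G.cap C - if (x ∈ C ↔ y ∈ C) then 0 else Δ := by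
  have hmem : s(x, y) ∈ Finset.univ.filter (fun e : Sym2 (Fin n) => e ∈ G.graph.edgeSet) := by
    simpa using hxy
  rw [cap_eq_sum, cap_eq_sum]
  change ∑ e ∈ Finset.univ.filter (fun e : Sym2 (Fin n) => e ∈ G.graph.edgeSet),
      (if Contributes e C then Function.update G.w s(x, y) (G.w s(x, y) - Δ) e else 0) = _
  rw [← Finset.add_sum_erase _ _ hmem, ← Finset.add_sum_erase _ _ hmem]
  have : ∀ e ∈ (Finset.univ.filter (fun e : Sym2 (Fin n) => e ∈ G.graph.edgeSet)).erase s(x, y),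
      (if Contributes e C then Function.update G.w s(x, y) (G.w s(x, y) - Δ) e else 0) =
        if Contributes e C then G.w e else 0 := by
    intro e he
    rw [Function.update_of_ne (Finset.ne_of_mem_erase he)]
  rw [Finset.sum_congr rfl this, Function.update_self]
  simp only [contributes_mk]
  by_cases h : x ∈ C ↔ y ∈ C <;> simp [h]
  ring

end WGraph

/-- The cut function of the star with centre `ρ` whose edge to `v` has capacity `2 ^ v`. -/
noncomputable def starCut {n : ℕ} (ρ : Fin n) (C : Finset (Fin n)) : ℝ :=
  ∑ v : Fin n, if (v ∈ C ↔ ρ ∈ C) then 0 else (2 : ℝ) ^ v.val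

theorem starCut_compl {n : ℕ} (ρ : Fin n) (C : Finset (Fin n)) :
    starCut ρ Cᶜ = starCut ρ C := by
  unfold starCut
  refine Finset.sum_congr rfl fun v _ => ?_
  have : (v ∈ Cᶜ ↔ ρ ∈ Cᶜ) ↔ (v ∈ C ↔ ρ ∈ C) := by simp only [Finset.mem_compl]; tauto
  simp only [this]

theorem starCut_submod {n : ℕ} (ρ : Fin n) (A B : Finset (Fin n)) :
    starCut ρ (A ∩ B) + starCut ρ (A ∪ B) ≤ starCut ρ A + starCut ρ B := by
  unfold starCut
  simp only [← Finset.sum_add_distrib]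
  refine Finset.sum_le_sum fun v _ => ?_
  simp only [Finset.mem_inter, Finset.mem_union]
  by_cases h1 : v ∈ A <;> by_cases h2 : v ∈ B <;> by_cases h3 : ρ ∈ A <;>
      by_cases h4 : ρ ∈ B <;> simp [h1, h2, h3, h4]

/-- On a set avoiding the centre the star cut is the number whose binary digits indicate the set,
and binary expansions are unique. -/
theorem starCut_inj_aux {n : ℕ} (ρ : Fin n) {A B : Finset (Fin n)} (hA : ρ ∉ A) (hB : ρ ∉ B)
    (h : starCut ρ A = starCut ρ B) : A = B := by
  have key : ∀ C : Finset (Fin n), ρ ∉ C →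
      starCut ρ C = ((∑ i ∈ C.map Fin.valEmbedding, 2 ^ i : ℕ) : ℝ) := by
    intro C hC
    unfold starCut
    rw [Finset.sum_map]
    push_cast
    rw [← Finset.sum_filter_add_sum_filter_not Finset.univ (fun v => v ∈ C)]
    simp only [hC, iff_false, ite_not]
    rw [Finset.sum_congr rfl (g := fun v : Fin n => (2 : ℝ) ^ v.val)
      (fun v hv => by simp [(Finset.mem_filter.mp hv).2])]
    rw [Finset.sum_eq_zero (s := Finset.univ.filter fun v => v ∉ C)
      (fun v hv => by simp [(Finset.mem_filter.mp hv).2])]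
    simp
  rw [key A hA, key B hB] at h
  have h2 := Finset.geomSum_injective (n := 2) le_rfl (Nat.cast_injective h)
  exact Finset.map_injective _ h2

theorem starCut_inj {n : ℕ} (ρ : Fin n) {A B : Finset (Fin n)}
    (h : starCut ρ A = starCut ρ B) : A = B ∨ A = Bᶜ := by
  by_cases hA : ρ ∈ A <;> by_cases hB : ρ ∈ B
  · left
    rw [← starCut_compl ρ A, ← starCut_compl ρ B] at h
    exact compl_injective (starCut_inj_aux ρ (by simpa) (by simpa) h)
  · right
    rw [← starCut_compl ρ A] at h
    rw [← starCut_inj_aux ρ (by simpa) hB h, compl_compl]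
  · right
    rw [← starCut_compl ρ B] at h
    exact starCut_inj_aux ρ hA (by simpa) h
  · exact .inl (starCut_inj_aux ρ hA hB h)

open Filter Topology in
/-- The cut capacities have a generic perturbation. -/
theorem WGraph.exists_isGenericCut {n : ℕ} (G : WGraph n) (ρ : Fin n) :
    ∃ h : Finset (Fin n) → ℝ, IsGenericCut h ∧ ∀ A B, h A ≤ h B → G.cap A ≤ G.cap B := by
  -- There are finitely many strict inequalities between capacities, and each survives for all small
  -- ε; the perturbation then only breaks ties.
  have hev : ∀ᶠ ε : ℝ in 𝓝[>] 0, ∀ A B : Finset (Fin n), G.cap A < G.cap B →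
      G.cap A + ε * starCut ρ A < G.cap B + ε * starCut ρ B := by
    rw [eventually_all]; intro A
    rw [eventually_all]; intro B
    by_cases hAB : G.cap A < G.cap B
    · simp only [hAB, true_imp_iff]
      have hc : ∀ C, Tendsto (fun ε : ℝ => G.cap C + ε * starCut ρ C) (𝓝[>] 0)
          (𝓝 (G.cap C + 0 * starCut ρ C)) := fun C =>
        Tendsto.mono_left (Continuous.tendsto (by fun_prop) _) nhdsWithin_le_nhds
      exact (hc A).eventually_lt (hc B) (by simpa using hAB)
    · simp [hAB]
  obtain ⟨ε, hε, hpos⟩ := (hev.and self_mem_nhdsWithin).exists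
  have hpos : 0 < ε := hpos
  refine ⟨fun C => G.cap C + ε * starCut ρ C, ⟨fun A => ?_, fun A B => ?_, fun A B h => ?_⟩,
    fun A B h => ?_⟩
  · simp only [G.cap_compl, starCut_compl]
  · nlinarith [G.cap_submod A B, mul_le_mul_of_nonneg_left (starCut_submod ρ A B) hpos.le]
  · rcases lt_trichotomy (G.cap A) (G.cap B) with h1 | h1 | h1
    · exact absurd h (hε A B h1).ne
    · simp only [h1, add_right_inj] at h
      exact starCut_inj ρ (mul_left_cancel₀ hpos.ne' h)
    · exact absurd h (hε B A h1).ne'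
  · by_contra hlt
    exact absurd (hε B A (not_le.mp hlt)) (not_lt.mpr h)

/-! ## Best cuts -/

/-- `C` is a Steiner cut separating `x` and `y` on which `h` is least. -/
structure IsBest {n : ℕ} (h : Finset (Fin n) → ℝ) (S : Finset (Fin n)) (x y : Fin n)
    (C : Finset (Fin n)) : Prop where
  steiner : IsSteinerCut S C
  sep : ¬ (x ∈ C ↔ y ∈ C)
  le : ∀ D, IsSteinerCut S D → ¬ (x ∈ D ↔ y ∈ D) → h C ≤ h D

theorem isSteinerCut_iff {n : ℕ} {S C : Finset (Fin n)} :
    IsSteinerCut S C ↔ ∃ s ∈ S, ∃ s' ∈ S, ¬ (s ∈ C ↔ s' ∈ C) := by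
  constructor
  · rintro ⟨s, hs, s', hs', h1, h2⟩
    exact ⟨s, hs, s', hs', by tauto⟩
  · rintro ⟨s, hs, s', hs', h⟩
    by_cases h1 : s ∈ C
    · exact ⟨s, hs, s', hs', h1, by tauto⟩
    · exact ⟨s', hs', s, hs, by tauto, h1⟩

theorem isSteinerCut_compl {n : ℕ} {S C : Finset (Fin n)} :
    IsSteinerCut S Cᶜ ↔ IsSteinerCut S C := by
  simp only [isSteinerCut_iff, Finset.mem_compl, not_iff_not]

theorem IsBest.symm {n : ℕ} {h : Finset (Fin n) → ℝ} {S : Finset (Fin n)} {x y : Fin n}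
    {C : Finset (Fin n)} (hC : IsBest h S x y C) : IsBest h S y x C :=
  ⟨hC.steiner, fun e => hC.sep e.symm, fun D hD hs => hC.le D hD fun e => hs e.symm⟩

theorem IsBest.compl {n : ℕ} {h : Finset (Fin n) → ℝ} (H : IsGenericCut h) {S : Finset (Fin n)}
    {x y : Fin n} {C : Finset (Fin n)} (hC : IsBest h S x y C) : IsBest h S x y Cᶜ :=
  ⟨isSteinerCut_compl.mpr hC.steiner,
    fun e => hC.sep (by simpa only [Finset.mem_compl, not_iff_not] using e),
    fun D hD hs => by rw [H.compl]; exact hC.le D hD hs⟩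

/-- A singleton suffices if x or y is Steiner; otherwise x together with one Steiner vertex does.
This makes the minimisation at each tree node range over a nonempty family. -/
theorem exists_isSteinerCut_sep {n : ℕ} {S : Finset (Fin n)} (hS : 2 ≤ S.card) {x y : Fin n}
    (hxy : x ≠ y) : ∃ C, IsSteinerCut S C ∧ ¬ (x ∈ C ↔ y ∈ C) := by
  classical
  obtain ⟨a, ha, b, hb, hab⟩ := Finset.one_lt_card.mp hS
  by_cases hx : x ∈ S
  · obtain ⟨s, hs, hsx⟩ := Finset.exists_mem_ne hS x
    exact ⟨{x}, ⟨x, hx, s, hs, by simp, by simpa⟩, by simpa using hxy.symm⟩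
  by_cases hy : y ∈ S
  · obtain ⟨s, hs, hsy⟩ := Finset.exists_mem_ne hS y
    exact ⟨{y}, ⟨y, hy, s, hs, by simp, by simpa⟩, by simpa using hxy⟩
  · refine ⟨{x, a}, ⟨a, ha, b, hb, by simp, ?_⟩, ?_⟩
    · have : b ≠ x := fun e => hx (e ▸ hb)
      simp [this, hab.symm]
    · have : y ≠ a := fun e => hy (e ▸ ha)
      simp [hxy.symm, this]

/-! ### Steiner mincuts after a capacity reduction -/

section Reduce

variable {n : ℕ} {G : WGraph n} {h : Finset (Fin n) → ℝ} {S C C₀ : Finset (Fin n)} {x y : Fin n}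

theorem WGraph.reduce_best_isSteinerMincut (hh : ∀ A B, h A ≤ h B → G.cap A ≤ G.cap B)
    (hxy : G.graph.Adj x y) (hC : IsBest h S x y C) (hC₀ : G.IsSteinerMincut S C₀) {Δ : ℝ}
    (hΔ : Δ ≤ G.w s(x, y)) (hlt : G.cap C - Δ ≤ G.cap C₀) :
    (G.reduce s(x, y) Δ hΔ).IsSteinerMincut S C := by
  refine ⟨hC.steiner, fun D hD => ?_⟩
  rw [G.reduce_cap hxy, G.reduce_cap hxy, if_neg hC.sep]
  split_ifs with hs
  · linarith [hC₀.2 D hD]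
  · linarith [hh _ _ (hC.le D hD hs)]

/-- No Steiner cut drops below the old minimum here. The old mincut keeps its capacity: if it
separates x and y, then c(C) ≤ c(C₀) ≤ c(C) - Δ forces Δ = 0. -/
theorem WGraph.reduce_min_isSteinerMincut (hh : ∀ A B, h A ≤ h B → G.cap A ≤ G.cap B)
    (hxy : G.graph.Adj x y) (hC : IsBest h S x y C) (hC₀ : G.IsSteinerMincut S C₀) {Δ : ℝ}
    (h0 : 0 ≤ Δ) (hΔ : Δ ≤ G.w s(x, y)) (hle : G.cap C₀ ≤ G.cap C - Δ) :
    (G.reduce s(x, y) Δ hΔ).IsSteinerMincut S C₀ ∧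
      (G.reduce s(x, y) Δ hΔ).cap C₀ = G.cap C₀ := by
  have h1 : (G.reduce s(x, y) Δ hΔ).cap C₀ = G.cap C₀ := by
    rw [G.reduce_cap hxy]
    split_ifs with hs
    · simp
    · have := hh _ _ (hC.le C₀ hC₀.1 hs)
      linarith
  refine ⟨⟨hC₀.1, fun D hD => ?_⟩, h1⟩
  rw [h1, G.reduce_cap hxy]
  split_ifs with hs
  · linarith [hC₀.2 D hD]
  · linarith [hh _ _ (hC.le D hD hs)]

theorem WGraph.reduce_steinerCap (hh : ∀ A B, h A ≤ h B → G.cap A ≤ G.cap B)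
    (hxy : G.graph.Adj x y) (hC : IsBest h S x y C) (hC₀ : G.IsSteinerMincut S C₀) {Δ : ℝ}
    (h0 : 0 ≤ Δ) (hΔ : Δ ≤ G.w s(x, y)) :
    (G.reduce s(x, y) Δ hΔ).steinerCap S = min (G.cap C₀) (G.cap C - Δ) := by
  rcases le_total (G.cap C₀) (G.cap C - Δ) with hle | hle
  · obtain ⟨h1, h2⟩ := G.reduce_min_isSteinerMincut hh hxy hC hC₀ h0 hΔ hle
    rw [min_eq_left hle, ← h1.cap_eq, h2]
  · rw [min_eq_right hle, ← (G.reduce_best_isSteinerMincut hh hxy hC hC₀ hΔ hle).cap_eq,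
      G.reduce_cap hxy, if_neg hC.sep]

end Reduce

/-- Best cuts of Steiner pairs do not cross. -/
theorem IsBest.laminar {n : ℕ} {h : Finset (Fin n) → ℝ} (H : IsGenericCut h)
    {S A B : Finset (Fin n)} {ρ s s' t t' : Fin n} (hs : s ∈ S) (hs' : s' ∈ S) (ht : t ∈ S)
    (ht' : t' ∈ S) (hA : IsBest h S s s' A) (hB : IsBest h S t t' B) (hρA : ρ ∉ A) (hρB : ρ ∉ B) :
    A ⊆ B ∨ B ⊆ A ∨ Disjoint A B := by
  wlog hle : h A ≤ h B generalizing A B s s' t t'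
  · rcases this ht ht' hs hs' hB hA hρB hρA (le_of_not_ge hle) with h1 | h1 | h1
    · exact .inr (.inl h1)
    · exact .inl h1
    · exact .inr (.inr h1.symm)
  wlog hsA : s ∈ A generalizing s s'
  · exact this hs' hs hA.symm (by have := hA.sep; tauto)
  wlog htB : t ∈ B generalizing t t'
  · exact this ht' ht hB.symm (by have := hB.sep; tauto)
  have hs'A : s' ∉ A := by have := hA.sep; tauto
  have ht'B : t' ∉ B := by have := hB.sep; tauto
  rcases hle.eq_or_lt with heq | hlt
  · rcases H.inj A B heq with rfl | rfl
    · exact .inl le_rfl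
    · simp [hρB] at hρA
  -- This is where the pairs must consist of Steiner vertices: every cut separating them is
  -- automatically a Steiner cut.
  have mA : ∀ D, ¬ (s ∈ D ↔ s' ∈ D) → h A ≤ h D := fun D hD =>
    hA.le D (isSteinerCut_iff.mpr ⟨s, hs, s', hs', hD⟩) hD
  have mB : ∀ D, ¬ (t ∈ D ↔ t' ∈ D) → h B ≤ h D := fun D hD =>
    hB.le D (isSteinerCut_iff.mpr ⟨t, ht, t', ht', hD⟩) hD
  -- A is strictly smaller than B, so it cannot separate t and t'. In each of the four cases below,
  -- one uncrossed set separates s, s' and the other t, t'. Sub- or posimodularity then forces the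
  -- first to have the value of A, so it is A or Aᶜ by genericity.
  have htt : t ∈ A ↔ t' ∈ A := by
    by_contra hc
    exact absurd (mB A hc) (not_le.mpr hlt)
  have sub := H.submod A B
  have pos := H.posimod A B
  by_cases htA : t ∈ A
  · have ht'A := htt.mp htA
    by_cases hs'B : s' ∈ B
    · have h1 := mA (B \ A) (by simp [*])
      have h2 := mB (A \ B) (by simp [*])
      rcases H.inj (B \ A) A (by linarith) with e | e
      · have : s' ∈ B \ A := Finset.mem_sdiff.mpr ⟨hs'B, hs'A⟩
        rw [e] at this
        exact absurd this hs'A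
      · have : ρ ∈ Aᶜ := by simpa
        rw [← e] at this
        exact absurd (Finset.mem_sdiff.mp this).1 hρB
    · have h1 := mA (A ∪ B) (by simp [*])
      have h2 := mB (A ∩ B) (by simp [*])
      rcases H.inj (A ∪ B) A (by linarith) with e | e
      · exact .inr (.inl (Finset.union_eq_left.mp e))
      · have : s ∈ A ∪ B := Finset.mem_union_left _ hsA
        rw [e] at this
        simp [hsA] at this
  · have ht'A : t' ∉ A := fun hh => htA (htt.mpr hh)
    by_cases hsB : s ∈ B
    · have h1 := mA (A ∩ B) (by simp [*])
      have h2 := mB (A ∪ B) (by simp [*])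
      rcases H.inj (A ∩ B) A (by linarith) with e | e
      · exact .inl (Finset.inter_eq_left.mp e)
      · have : s ∈ A ∩ B := Finset.mem_inter.mpr ⟨hsA, hsB⟩
        rw [e] at this
        simp [hsA] at this
    · have h1 := mA (A \ B) (by simp [*])
      have h2 := mB (B \ A) (by simp [*])
      rcases H.inj (A \ B) A (by linarith) with e | e
      · exact .inr (.inr (Finset.sdiff_eq_self_iff_disjoint.mp e))
      · have : s ∈ A \ B := Finset.mem_sdiff.mpr ⟨hsA, hsB⟩
        rw [e] at this
        simp [hsA] at this

/-! ## Trees of cuts -/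

/-- A full binary tree with vertices at its leaves and cuts at its internal nodes. -/
inductive CutTree (n : ℕ)
  | leaf (v : Fin n)
  | node (C : Finset (Fin n)) (left right : CutTree n)

/-- The capacities at the internal nodes. -/
def CapTree.caps {n : ℕ} : CapTree n → List ℝ
  | leaf _ => []
  | node c l r => l.caps ++ c :: r.caps

namespace CutTree

variable {n : ℕ}

/-- The leaves from left to right. -/
def leaves : CutTree n → List (Fin n)
  | leaf v => [v]
  | node _ l r => l.leaves ++ r.leaves

/-- The cuts in symmetric order. -/
def cuts : CutTree n → List (Finset (Fin n))
  | leaf _ => []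
  | node C l r => l.cuts ++ C :: r.cuts

/-- The capacity tree of a tree of cuts. -/
noncomputable def toCap (G : WGraph n) : CutTree n → CapTree n
  | leaf v => .leaf {v}
  | node C l r => .node (G.cap C) (l.toCap G) (r.toCap G)

/-- Every node carries a Steiner cut which separates the leaves of its two subtrees and is least
among all Steiner cuts splitting the set of leaves below it. -/
def Optimal (h : Finset (Fin n) → ℝ) (S : Finset (Fin n)) : CutTree n → Prop
  | leaf _ => True
  | node C l r => (∀ x ∈ l.leaves, x ∈ C) ∧ (∀ x ∈ r.leaves, x ∉ C) ∧ IsSteinerCut S C ∧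
      (∀ D, IsSteinerCut S D → ∀ x ∈ l.leaves ++ r.leaves, ∀ y ∈ l.leaves ++ r.leaves,
        ¬ (x ∈ D ↔ y ∈ D) → h C ≤ h D) ∧ l.Optimal h S ∧ r.Optimal h S

theorem length_cuts (t : CutTree n) : t.cuts.length + 1 = t.leaves.length := by
  induction t with
  | leaf v => rfl
  | node C l r hl hr => simp only [cuts, leaves, List.length_append, List.length_cons]; omega

theorem toCap_verts (G : WGraph n) (t : CutTree n) : (t.toCap G).verts = t.leaves.toFinset := by
  induction t with
  | leaf v => rfl
  | node C l r hl hr => simp [toCap, CapTree.verts, leaves, hl, hr]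

theorem toCap_caps (G : WGraph n) (t : CutTree n) : (t.toCap G).caps = t.cuts.map G.cap := by
  induction t with
  | leaf v => rfl
  | node C l r hl hr => simp [toCap, CapTree.caps, cuts, hl, hr]

theorem toCap_numNodes (G : WGraph n) (t : CutTree n) :
    (t.toCap G).numNodes + 1 = 2 * t.leaves.length := by
  induction t with
  | leaf v => rfl
  | node C l r hl hr =>
    simp only [toCap, CapTree.numNodes, leaves, List.length_append]; omega

theorem toCap_disjointLeaves (G : WGraph n) (t : CutTree n) (ht : t.leaves.Nodup) :
    (t.toCap G).DisjointLeaves := by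
  induction t with
  | leaf v => trivial
  | node C l r hl hr =>
    rw [leaves, List.nodup_append'] at ht
    refine ⟨?_, hl ht.1, hr ht.2.1⟩
    rw [toCap_verts, toCap_verts, Finset.disjoint_left]
    intro a ha hb
    exact ht.2.2 (List.mem_toFinset.mp ha) (List.mem_toFinset.mp hb)

variable {h : Finset (Fin n) → ℝ} {S : Finset (Fin n)}

theorem exists_optimal (hS : 2 ≤ S.card) (X : Finset (Fin n)) (hX : X.Nonempty) :
    ∃ t : CutTree n, t.leaves.toFinset = X ∧ t.leaves.Nodup ∧ t.Optimal h S := by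
  classical
  induction hm : X.card using Nat.strong_induction_on generalizing X with
  | _ m ih =>
    subst hm
    rcases hX.card_pos.nat_succ_le.eq_or_lt with h1 | h1
    · obtain ⟨v, rfl⟩ := Finset.card_eq_one.mp h1.symm
      exact ⟨leaf v, by simp [leaves], by simp [leaves], trivial⟩
    · obtain ⟨a, ha, b, hb, hab⟩ := Finset.one_lt_card.mp h1
      obtain ⟨C₁, hC₁, hab₁⟩ := exists_isSteinerCut_sep hS hab
      -- The candidates are Steiner cuts of the whole graph; only the splitting condition refers to
      -- X.
      obtain ⟨C, hC, hmin⟩ := Finset.exists_min_image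
        (Finset.univ.filter fun C => IsSteinerCut S C ∧ ∃ x ∈ X, ∃ y ∈ X, ¬ (x ∈ C ↔ y ∈ C)) h
        ⟨C₁, by simpa using ⟨hC₁, a, ha, b, hb, by simpa using hab₁⟩⟩
      obtain ⟨-, hCS, x, hx, y, hy, hxy⟩ := Finset.mem_filter.mp hC
      wlog hxC : x ∈ C generalizing x y
      · exact this y hy x hx (by tauto) (by tauto)
      have hyC : y ∉ C := by tauto
      obtain ⟨l, hl1, hl2, hl3⟩ := ih (X ∩ C).card
        (Finset.card_lt_card ⟨Finset.inter_subset_left, fun hh => hyC (Finset.mem_inter.mp (hh hy)).2⟩)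
        (X ∩ C) ⟨x, by simp [*]⟩ rfl
      obtain ⟨r, hr1, hr2, hr3⟩ := ih (X \ C).card
        (Finset.card_lt_card ⟨Finset.sdiff_subset, fun hh => (Finset.mem_sdiff.mp (hh hx)).2 hxC⟩)
        (X \ C) ⟨y, by simp [*]⟩ rfl
      have ml : ∀ z, z ∈ l.leaves ↔ z ∈ X ∧ z ∈ C := fun z => by
        rw [← List.mem_toFinset, hl1, Finset.mem_inter]
      have mr : ∀ z, z ∈ r.leaves ↔ z ∈ X ∧ z ∉ C := fun z => by
        rw [← List.mem_toFinset, hr1, Finset.mem_sdiff]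
      have mX : ∀ z, z ∈ l.leaves ++ r.leaves → z ∈ X := fun z hz => by
        rcases List.mem_append.mp hz with hz | hz
        · exact ((ml z).mp hz).1
        · exact ((mr z).mp hz).1
      refine ⟨node C l r, ?_, ?_, fun z hz => ((ml z).mp hz).2, fun z hz => ((mr z).mp hz).2, hCS,
        fun D hD u hu v hv huv => hmin D (by simpa using ⟨hD, u, mX u hu, v, mX v hv, by simpa using huv⟩),
        hl3, hr3⟩
      · rw [leaves, List.toFinset_append, hl1, hr1, Finset.union_comm, Finset.sdiff_union_inter]
      · rw [leaves, List.nodup_append']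
        exact ⟨hl2, hr2, fun z hz hz' => ((mr z).mp hz').2 ((ml z).mp hz).2⟩

/-- A cut deep in the tree splits the leaves below its own node, hence all leaves of the tree. It
thus competes with the root cut, which gives the heap order of the values. -/
theorem Optimal.splits {t : CutTree n} (ht : t.Optimal h S) {C : Finset (Fin n)}
    (hC : C ∈ t.cuts) :
    IsSteinerCut S C ∧ ∃ x ∈ t.leaves, ∃ y ∈ t.leaves, ¬ (x ∈ C ↔ y ∈ C) := by
  have hne : ∀ t : CutTree n, ∃ x, x ∈ t.leaves := fun t =>
    List.exists_mem_of_length_pos (by rw [← t.length_cuts]; omega)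
  induction t with
  | leaf v => simp [cuts] at hC
  | node C₀ l r hl hr =>
    obtain ⟨h1, h2, h3, h4, h5, h6⟩ := ht
    simp only [cuts, List.mem_append, List.mem_cons] at hC
    rcases hC with hC | rfl | hC
    · obtain ⟨e, x, hx, y, hy, hxy⟩ := hl h5 hC
      exact ⟨e, x, by simp [leaves, hx], y, by simp [leaves, hy], hxy⟩
    · obtain ⟨x, hx⟩ := hne l
      obtain ⟨y, hy⟩ := hne r
      exact ⟨h3, x, by simp [leaves, hx], y, by simp [leaves, hy],
        by simp [h1 x hx, h2 y hy]⟩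
    · obtain ⟨e, x, hx, y, hy, hxy⟩ := hr h6 hC
      exact ⟨e, x, by simp [leaves, hx], y, by simp [leaves, hy], hxy⟩

theorem Optimal.isBest_root {C : Finset (Fin n)} {l r : CutTree n}
    (ht : (node C l r).Optimal h S) {x y : Fin n} (hx : x ∈ l.leaves) (hy : y ∈ r.leaves) :
    IsBest h S x y C :=
  ⟨ht.2.2.1, by simp [ht.1 x hx, ht.2.1 y hy], fun D hD hs =>
    ht.2.2.2.1 D hD x (List.mem_append_left _ hx) y (List.mem_append_right _ hy) hs⟩

theorem Optimal.exists_lcaCap (G : WGraph n) {t : CutTree n} (ht : t.Optimal h S) {x y : Fin n}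
    (hx : x ∈ t.leaves) (hy : y ∈ t.leaves) (hxy : x ≠ y) :
    ∃ C, IsBest h S x y C ∧ (t.toCap G).lcaCap x y = some (G.cap C) := by
  induction t with
  | leaf v =>
    simp only [leaves, List.mem_singleton] at hx hy
    exact absurd (hx.trans hy.symm) hxy
  | node C l r hl hr =>
    simp only [toCap, CapTree.lcaCap, toCap_verts, List.mem_toFinset]
    split_ifs with h1 h2
    · exact hl ht.2.2.2.2.1 h1.1 h1.2
    · exact hr ht.2.2.2.2.2 h2.1 h2.2
    · refine ⟨C, ?_, rfl⟩
      simp only [leaves, List.mem_append] at hx hy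
      rcases hx with hx | hx
      · exact ht.isBest_root hx (by tauto)
      · exact (ht.isBest_root (by tauto) hx).symm

/-- A least cut among the gaps between two leaves is a best cut for them. -/
theorem Optimal.isBest_of_min (H : IsGenericCut h) {t : CutTree n} (ht : t.Optimal h S)
    {i j k : ℕ} {x y : Fin n} {C : Finset (Fin n)} (hx : t.leaves[i]? = some x)
    (hy : t.leaves[j]? = some y) (hik : i ≤ k) (hkj : k < j) (hC : t.cuts[k]? = some C)
    (hmin : ∀ k' C', i ≤ k' → k' < j → t.cuts[k']? = some C' → h C ≤ h C') :
    IsBest h S x y C := by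
  induction t generalizing i j k with
  | leaf v => simp [cuts] at hC
  | node C₀ l r hl hr =>
    have len := l.length_cuts
    by_cases hj : j < l.leaves.length
    · have e : ∀ k', k' < j → (node C₀ l r).cuts[k']? = l.cuts[k']? := fun k' hk' => by
        rw [cuts, List.getElem?_append_left (by omega)]
      rw [leaves, List.getElem?_append_left (by omega)] at hx hy
      rw [e k hkj] at hC
      exact hl ht.2.2.2.2.1 hx hy hik hkj hC fun k' C' h1 h2 h3 => hmin k' C' h1 h2 (by rw [e k' h2, h3])
    · by_cases hi : i < l.leaves.length
      · have h1 : h C ≤ h C₀ := hmin (l.cuts.length) C₀ (by omega) (by omega) (by simp [cuts])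
        obtain ⟨hS, u, hu, v, hv, huv⟩ := ht.splits (List.mem_of_getElem? hC)
        have h2 : h C₀ ≤ h C := ht.2.2.2.1 C hS u hu v hv huv
        rw [leaves, List.getElem?_append_left (by omega)] at hx
        rw [leaves, List.getElem?_append_right (by omega)] at hy
        have h3 := ht.isBest_root (List.mem_of_getElem? hx) (List.mem_of_getElem? hy)
        rcases H.inj C C₀ (le_antisymm h1 h2) with rfl | rfl
        · exact h3
        · exact h3.compl H
      · have e : ∀ k', (node C₀ l r).cuts[k' + l.leaves.length]? = r.cuts[k']? := fun k' => by
          rw [cuts, List.getElem?_append_right (by omega), show k' + l.leaves.length - l.cuts.length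
            = k' + 1 by omega, List.getElem?_cons_succ]
        rw [leaves, List.getElem?_append_right (by omega)] at hx hy
        obtain ⟨k, rfl⟩ : ∃ k', k = k' + l.leaves.length := ⟨k - l.leaves.length, by omega⟩
        rw [e] at hC
        exact hr ht.2.2.2.2.2 hx hy (by omega) (by omega) hC fun k' C' h1 h2 h3 =>
          hmin (k' + l.leaves.length) C' (by omega) (by omega) (by rw [e k', h3])

open Classical in
/-- All but `n - |S|` cuts are best for a pair of Steiner vertices. -/
theorem Optimal.countP_not_isBest {t : CutTree n} (ht : t.Optimal h S) :
    t.cuts.countP (fun C => ¬ ∃ s ∈ S, ∃ s' ∈ S, IsBest h S s s' C) +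
      max 1 (t.leaves.countP (fun v => v ∈ S)) ≤ t.leaves.length := by
  induction t with
  | leaf v => simp [cuts, leaves, List.countP_cons]; split_ifs <;> simp
  | node C l r hl hr =>
    have hl := hl ht.2.2.2.2.1
    have hr := hr ht.2.2.2.2.2
    simp only [cuts, leaves, List.countP_append, List.countP_cons, List.length_append]
    by_cases hl0 : l.leaves.countP (fun v => v ∈ S) = 0
    -- A side without Steiner leaves still contributes 1 through `max 1`, because it has one cut
    -- fewer than leaves; this slack pays for a root cut that is not best for a Steiner pair.
    · split_ifs <;> omega
    · by_cases hr0 : r.leaves.countP (fun v => v ∈ S) = 0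
      · split_ifs <;> omega
      · obtain ⟨s, hs, hsS⟩ := List.countP_pos_iff.mp (Nat.pos_of_ne_zero hl0)
        obtain ⟨s', hs', hsS'⟩ := List.countP_pos_iff.mp (Nat.pos_of_ne_zero hr0)
        have hb : ∃ s ∈ S, ∃ s' ∈ S, IsBest h S s s' C :=
          ⟨s, by simpa using hsS, s', by simpa using hsS', ht.isBest_root hs hs'⟩
        rw [if_neg (by simpa using hb)]
        omega

end CutTree

/-! ## Storing the cuts -/

/-- A laminar family of sets can be arranged so that its members are contiguous. -/
theorem exists_list_of_laminar {α : Type*} [DecidableEq α] (F : Finset (Finset α)) (U : Finset α)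
    (hU : ∀ A ∈ F, A ⊆ U)
    (hF : ∀ A ∈ F, ∀ B ∈ F, A ⊆ B ∨ B ⊆ A ∨ Disjoint A B) :
    ∃ l : List α, l.Nodup ∧ l.toFinset = U ∧ ∀ A ∈ F, ∃ a, a <:+: l ∧ a.toFinset = A := by
  induction hm : F.card using Nat.strong_induction_on generalizing F U with
  | _ m ih =>
    subst hm
    rcases F.eq_empty_or_nonempty with rfl | hne
    · exact ⟨U.toList, U.nodup_toList, U.toList_toFinset, by simp⟩
    -- Every other member lies inside M or is disjoint from it, so arrangements of M and of its
    -- complement in U can be concatenated.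
    obtain ⟨M, hM⟩ := F.exists_maximal hne
    obtain ⟨l₁, n₁, t₁, i₁⟩ := ih ((F.erase M).filter (· ⊆ M)).card
      ((Finset.card_filter_le _ _).trans_lt (Finset.card_erase_lt_of_mem hM.prop))
      ((F.erase M).filter (· ⊆ M)) M (fun A hA => (Finset.mem_filter.mp hA).2)
      (fun A hA B hB => hF A (by simp at hA; tauto) B (by simp at hB; tauto)) rfl
    obtain ⟨l₂, n₂, t₂, i₂⟩ := ih ((F.erase M).filter (Disjoint M ·)).card
      ((Finset.card_filter_le _ _).trans_lt (Finset.card_erase_lt_of_mem hM.prop))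
      ((F.erase M).filter (Disjoint M ·)) (U \ M)
      (fun A hA => by
        simp only [Finset.mem_filter, Finset.mem_erase] at hA
        exact Finset.subset_sdiff.mpr ⟨hU A hA.1.2, hA.2.symm⟩)
      (fun A hA B hB => hF A (by simp at hA; tauto) B (by simp at hB; tauto)) rfl
    refine ⟨l₁ ++ l₂, ?_, ?_, fun A hA => ?_⟩
    · refine List.nodup_append'.mpr ⟨n₁, n₂, fun z hz hz' => ?_⟩
      rw [← List.mem_toFinset, t₁] at hz
      rw [← List.mem_toFinset, t₂] at hz'
      exact (Finset.mem_sdiff.mp hz').2 hz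
    · rw [List.toFinset_append, t₁, t₂, Finset.union_sdiff_of_subset (hU M hM.prop)]
    · by_cases hAM : A = M
      · exact ⟨l₁, (List.prefix_append l₁ l₂).isInfix, by rw [t₁, hAM]⟩
      rcases hF A hA M hM.prop with h | h | h
      · obtain ⟨a, ha, ha'⟩ := i₁ A (by simp [*])
        exact ⟨a, ha.trans (List.prefix_append l₁ l₂).isInfix, ha'⟩
      · exact absurd (le_antisymm (hM.le_of_ge hA h) h) hAM
      · obtain ⟨a, ha, ha'⟩ := i₂ A (by simp [*, h.symm])
        exact ⟨a, ha.trans (List.suffix_append l₁ l₂).isInfix, ha'⟩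

theorem List.length_flatMap_le {α β : Type*} (l : List α) (f : α → List β) (m : ℕ)
    (hf : ∀ a, (f a).length ≤ m) : (l.flatMap f).length ≤ l.length * m := by
  induction l with
  | nil => simp
  | cons a l ih =>
    rw [List.flatMap_cons, List.length_append, List.length_cons, Nat.succ_mul]
    have := hf a
    omega

theorem List.isInfix_flatMap {α β : Type*} {l : List α} {a : α} (ha : a ∈ l) (f : α → List β) :
    f a <:+: l.flatMap f := by
  induction l with
  | nil => simp at ha
  | cons b l ih =>
    rw [List.flatMap_cons]
    rcases List.mem_cons.mp ha with rfl | ha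
    · exact (List.prefix_append _ _).isInfix
    · exact (ih ha).trans (List.suffix_append _ _).isInfix

/-- The cuts of an optimal tree, and one further set, are stored up to complement as infixes of a
list of length `O(n (n - |S| + 1))`. -/
theorem CutTree.Optimal.exists_store {n : ℕ} {h : Finset (Fin n) → ℝ} (H : IsGenericCut h)
    {S : Finset (Fin n)} {t : CutTree n} (ht : t.Optimal h S) (hnd : t.leaves.Nodup)
    (huniv : t.leaves.toFinset = Finset.univ) (ρ : Fin n) (C₀ : Finset (Fin n)) :
    ∃ mem : List (Fin n), mem.length ≤ 2 * (n * (n - S.card + 1)) ∧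
      ∀ C ∈ C₀ :: t.cuts, ∃ a, a <:+: mem ∧ a.Nodup ∧ (a.toFinset = C ∨ a.toFinset = Cᶜ) := by
  classical
  let p : Finset (Fin n) → Prop := fun C => ∃ s ∈ S, ∃ s' ∈ S, IsBest h S s s' C
  obtain ⟨L, hL1, hL2, hL3⟩ := exists_list_of_laminar
    (Finset.univ.filter fun C : Finset (Fin n) => p C ∧ ρ ∉ C) Finset.univ
    (fun A _ => Finset.subset_univ A) (by
      intro A hA B hB
      simp only [Finset.mem_filter, Finset.mem_univ, true_and] at hA hB
      obtain ⟨⟨s, hs, s', hs', hA⟩, hρA⟩ := hA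
      obtain ⟨⟨t, ht, t', ht', hB⟩, hρB⟩ := hB
      exact hA.laminar H hs hs' ht ht' hB hρA hρB)
  have hLn : L.length = n := by
    rw [← List.toFinset_card_of_nodup hL1, hL2, Finset.card_univ, Fintype.card_fin]
  have hlen : t.leaves.length = n := by
    rw [← List.toFinset_card_of_nodup hnd, huniv, Finset.card_univ, Fintype.card_fin]
  have hSc : t.leaves.countP (fun v => v ∈ S) = S.card := by
    rw [List.countP_eq_length_filter, ← List.toFinset_card_of_nodup (hnd.filter _),
      List.toFinset_filter, huniv]
    simp
  have hcount := ht.countP_not_isBest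
  rw [hSc, hlen] at hcount
  let E := C₀ :: t.cuts.filter fun C => ¬ p C
  have hE : E.length ≤ n - S.card + 1 := by
    rw [List.length_cons, ← List.countP_eq_length_filter]
    simp only [p]
    have : S.card ≤ n := by simpa using S.card_le_univ
    omega
  refine ⟨L ++ E.flatMap Finset.toList, ?_, fun C hC => ?_⟩
  · have h1 := E.length_flatMap_le Finset.toList n fun A => by
      simpa using A.card_le_univ
    rw [List.length_append, hLn]
    nlinarith [Nat.mul_le_mul_right n hE, Nat.zero_le (n * (n - S.card))]
  · by_cases hCE : C ∈ E
    · exact ⟨C.toList, (List.isInfix_flatMap hCE _).trans (List.suffix_append _ _).isInfix,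
        C.nodup_toList, .inl C.toList_toFinset⟩
    · have hp : p C := by
        by_contra hp
        rcases List.mem_cons.mp hC with rfl | hC
        · exact hCE (by simp [E])
        · exact hCE (List.mem_cons_of_mem _ (List.mem_filter.mpr ⟨hC, by simpa using hp⟩))
      by_cases hρ : ρ ∈ C
      · obtain ⟨s, hs, s', hs', hb⟩ := hp
        obtain ⟨a, ha, ha'⟩ := hL3 Cᶜ (by
          simp only [Finset.mem_filter, Finset.mem_univ, true_and]
          exact ⟨⟨s, hs, s', hs', hb.compl H⟩, by simpa⟩)
        exact ⟨a, ha.trans (List.prefix_append _ _).isInfix, hL1.sublist ha.sublist, .inr ha'⟩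
      · obtain ⟨a, ha, ha'⟩ := hL3 C (by
          simp only [Finset.mem_filter, Finset.mem_univ, true_and]
          exact ⟨hp, hρ⟩)
        exact ⟨a, ha.trans (List.prefix_append _ _).isInfix, hL1.sublist ha.sublist, .inl ha'⟩

/-! ## Memory layout -/

/-- The position of the table `f` in `packTables tabs`. -/
def tableBase (tabs : List (List ℕ)) (f : ℕ) : ℕ :=
  tabs.length + ((tabs.take f).map List.length).sum

/-- The tables `tabs`, preceded by an array of pointers to them. -/
def packTables (tabs : List (List ℕ)) : List ℕ :=
  (List.range tabs.length).map (tableBase tabs) ++ tabs.flatten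

theorem length_packTables (tabs : List (List ℕ)) :
    (packTables tabs).length = tabs.length + (tabs.map List.length).sum := by
  simp [packTables, List.length_flatten]

theorem packTables_pointer {tabs : List (List ℕ)} {f : ℕ} (hf : f < tabs.length) :
    (packTables tabs)[f]? = some (tableBase tabs f) := by
  rw [packTables, List.getElem?_append_left (by simpa)]
  simp [hf]

theorem flatten_getElem? {α : Type*} {tabs : List (List α)} {f k : ℕ} {t : List α} {v : α}
    (hf : tabs[f]? = some t) (hk : t[k]? = some v) :
    tabs.flatten[((tabs.take f).map List.length).sum + k]? = some v := by
  induction tabs generalizing f with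
  | nil => simp at hf
  | cons s tabs ih =>
    cases f with
    | zero =>
      simp only [List.getElem?_cons_zero, Option.some.injEq] at hf
      subst hf
      have := (List.getElem?_eq_some_iff.mp hk).1
      simpa [List.getElem?_append_left this] using hk
    | succ f =>
      rw [List.getElem?_cons_succ] at hf
      rw [List.flatten_cons, List.take_succ_cons, List.map_cons, List.sum_cons,
        List.getElem?_append_right (by omega), ← ih hf]
      congr 1
      omega

theorem packTables_entry {tabs : List (List ℕ)} {f k : ℕ} {t : List ℕ} {v : ℕ}
    (hf : tabs[f]? = some t) (hk : t[k]? = some v) :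
    (packTables tabs)[tableBase tabs f + k]? = some v := by
  rw [packTables, tableBase, List.getElem?_append_right (by simp; omega), ← flatten_getElem? hf hk]
  congr 1
  simp
  omega

theorem tableBase_le {tabs : List (List ℕ)} (f : ℕ) :
    tableBase tabs f ≤ (packTables tabs).length := by
  rw [length_packTables, tableBase]
  have : (tabs.map List.length).sum =
      ((tabs.take f).map List.length).sum + ((tabs.drop f).map List.length).sum := by
    rw [← List.sum_append, ← List.map_append, List.take_append_drop]
  omega

theorem mem_packTables {tabs : List (List ℕ)} {v : ℕ} (hv : v ∈ packTables tabs) :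
    v ≤ (packTables tabs).length ∨ ∃ t ∈ tabs, v ∈ t := by
  rcases List.mem_append.mp hv with hv | hv
  · obtain ⟨f, -, rfl⟩ := List.mem_map.mp hv
    exact .inl (tableBase_le f)
  · exact .inr (by simpa using hv)

/-! ### Encoding a capacity tree as linked records -/

namespace CapTree

variable {n : ℕ}

/-- The records of the tree when its root record is stored at address `a`. -/
noncomputable def encode (idx : ℝ → ℕ) : CapTree n → ℕ → List ℕ
  | leaf _, _ => [0]
  | node c l r, a => 1 :: idx c :: (a + 4) :: (a + 4 + (l.encode idx (a + 4)).length) ::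
      (l.encode idx (a + 4) ++ r.encode idx (a + 4 + (l.encode idx (a + 4)).length))

/-- The address of the leaf of `u` when the root record is stored at address `a`. -/
noncomputable def leafAddr (idx : ℝ → ℕ) : CapTree n → ℕ → Fin n → ℕ
  | leaf _, a, _ => a
  | node _ l r, a, u => if u ∈ l.verts then l.leafAddr idx (a + 4) u
      else r.leafAddr idx (a + 4 + (l.encode idx (a + 4)).length) u

theorem length_encode_le (idx : ℝ → ℕ) (T : CapTree n) (a : ℕ) :
    (T.encode idx a).length ≤ 4 * T.numNodes := by
  induction T generalizing a with
  | leaf U => simp [encode, numNodes]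
  | node c l r hl hr =>
    have h1 := hl (a + 4)
    have h2 := hr (a + 4 + (l.encode idx (a + 4)).length)
    simp only [encode, numNodes, List.length_cons, List.length_append]
    omega

theorem encode_entry_le {idx : ℝ → ℕ} {T : CapTree n} {a M v : ℕ}
    (hM : a + (T.encode idx a).length ≤ M) (hidx : ∀ c ∈ T.caps, idx c ≤ M)
    (hv : v ∈ T.encode idx a) : v ≤ M := by
  induction T generalizing a with
  | leaf U => simp [encode] at hv; omega
  | node c l r hl hr =>
    simp only [encode, List.length_cons, List.length_append, List.mem_cons, List.mem_append] at hM hv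
    simp only [caps, List.mem_append, List.mem_cons] at hidx
    rcases hv with rfl | rfl | rfl | rfl | hv | hv
    · omega
    · exact hidx c (by simp)
    · omega
    · omega
    · exact hl (by omega) (fun c hc => hidx c (by simp [hc])) hv
    · exact hr (by omega) (fun c hc => hidx c (by simp [hc])) hv

theorem leafAddr_le (idx : ℝ → ℕ) (T : CapTree n) (a : ℕ) (u : Fin n) :
    T.leafAddr idx a u ≤ a + (T.encode idx a).length := by
  induction T generalizing a with
  | leaf U => simp [leafAddr]
  | node c l r hl hr =>
    have h1 := hl (a + 4)
    have h2 := hr (a + 4 + (l.encode idx (a + 4)).length)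
    simp only [encode, leafAddr, List.length_cons, List.length_append]
    split_ifs <;> omega

/-- The index `idx` depends only on the value, so nodes of equal capacity may share a real cell.
Disjointness of the leaves makes the left-first choice in `leafAddr` correct. -/
theorem storedAt_of_encode {idx : ℝ → ℕ} {T : CapTree n} {D : DataStruct} {base a : ℕ}
    (hT : T.DisjointLeaves) (hw : ∀ k v, (T.encode idx a)[k]? = some v → D.words[a + k]? = some v)
    (hb : ∀ u ∈ T.verts, D.words[base + u.val]? = some (T.leafAddr idx a u))
    (hc : ∀ c ∈ T.caps, D.reals[idx c]? = some c) : T.StoredAt D base a := by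
  induction T generalizing a with
  | leaf U => exact ⟨hw 0 0 rfl, hb⟩
  | node c l r hl hr =>
    obtain ⟨hd, hdl, hdr⟩ := hT
    simp only [caps, List.mem_append, List.mem_cons] at hc
    have hcons : ∀ k, ((node c l r).encode idx a)[k + 4]? = (l.encode idx (a + 4) ++
        r.encode idx (a + 4 + (l.encode idx (a + 4)).length))[k]? := fun k => by
      simp [encode]
    refine ⟨hw 0 1 rfl, idx c, a + 4, a + 4 + (l.encode idx (a + 4)).length, hw 1 _ rfl,
      hc c (by simp), hw 2 _ rfl, hl hdl (fun k v hk => ?_) (fun u hu => ?_) (fun c hc' => hc c (by simp [hc'])),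
      hw 3 _ rfl, hr hdr (fun k v hk => ?_) (fun u hu => ?_) (fun c hc' => hc c (by simp [hc']))⟩
    · rw [show a + 4 + k = a + (k + 4) by omega]
      refine hw _ _ ?_
      rw [hcons, List.getElem?_append_left (List.getElem?_eq_some_iff.mp hk).1, hk]
    · rw [hb u (Finset.mem_union_left _ hu), leafAddr, if_pos hu]
    · rw [show a + 4 + (l.encode idx (a + 4)).length + k
        = a + ((l.encode idx (a + 4)).length + k + 4) by omega]
      refine hw _ _ ?_
      rw [hcons, List.getElem?_append_right (by omega), ← hk]
      congr 1
      omega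
    · rw [hb u (Finset.mem_union_right _ hu), leafAddr,
        if_neg (fun h => Finset.disjoint_left.mp hd h hu)]

end CapTree

/-! ## Running programs -/

/-- Started in `c`, the machine reaches within `T` steps a configuration satisfying `Q`. -/
def Runs (P : List Instr) (D : DataStruct) (b T : ℕ) (c : Config) (Q : Config → Prop) : Prop :=
  ∃ t ≤ T, Q ((step P D b)^[t] c)

/-- The memory stores the values of `g` on `0, …, N - 1` as the table `f`. -/
def FnTable (D : DataStruct) (b f N : ℕ) (g : ℕ → ℕ) : Prop :=
  ∃ base, D.words[f]? = some base ∧ ∀ k < N, base + k < 2 ^ b ∧ D.words[base + k]? = some (g k)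

/-- Code loading the entry of the table `f` at the index in register `a` into register `d`. -/
def lookup (f d a : ℕ) : List Instr :=
  [.const 2 f, .load 2 2, .op .add 2 2 a, .load d 2]

section Runs

variable {P : List Instr} {D : DataStruct} {b T : ℕ} {Q : Config → Prop}

theorem FnTable.lt {f N : ℕ} {g : ℕ → ℕ} (h : FnTable D b f N g) {k : ℕ} (hk : k < N) :
    k < 2 ^ b := by
  obtain ⟨base, -, h⟩ := h
  have := (h k hk).1
  omega

theorem Runs.of {c : Config} (h : Q c) : Runs P D b T c Q := ⟨0, Nat.zero_le _, h⟩

theorem Runs.mono {T' : ℕ} {c : Config} (hT : T ≤ T') (h : Runs P D b T c Q) :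
    Runs P D b T' c Q :=
  let ⟨t, ht, hQ⟩ := h
  ⟨t, ht.trans hT, hQ⟩

theorem Runs.bind {T' : ℕ} {c : Config} {R : Config → Prop} (h : Runs P D b T c R)
    (h' : ∀ c', R c' → Runs P D b T' c' Q) : Runs P D b (T + T') c Q := by
  obtain ⟨t, ht, hR⟩ := h
  obtain ⟨t', ht', hQ⟩ := h' _ hR
  refine ⟨t' + t, by omega, ?_⟩
  rwa [Function.iterate_add_apply]

theorem Runs.step {c : Config} {i : Instr} (hP : P[c.pc]? = some i)
    (h : Runs P D b T (i.exec D b c) Q) : Runs P D b (T + 1) c Q := by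
  obtain ⟨t, ht, hQ⟩ := h
  refine ⟨t + 1, by omega, ?_⟩
  rw [Function.iterate_succ_apply, _root_.step, hP]
  exact hQ

/-- Register 2 is scratch, so the index may not live there and the continuation must accept any
value z left in it. The address bound in `FnTable` keeps the addition from wrapping. -/
theorem Runs.lookup {p : ℕ} {w : ℕ → ℕ} {r : ℕ → ℝ} {oW : List ℕ} {oR : List ℝ}
    {f d a N k : ℕ} {g : ℕ → ℕ}
    (hP : P[p]? = some (.const 2 f) ∧ P[p + 1]? = some (.load 2 2) ∧
      P[p + 2]? = some (.op .add 2 2 a) ∧ P[p + 3]? = some (.load d 2))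
    (hf : f < 2 ^ b) (ha : a ≠ 2) (hg : FnTable D b f N g) (hwa : w a = k) (hk : k < N)
    (h : ∀ z, Runs P D b T ⟨p + 4, Function.update (Function.update w 2 z) d (g k), r, oW, oR⟩ Q) :
    Runs P D b (T + 4) ⟨p, w, r, oW, oR⟩ Q := by
  obtain ⟨base, hb, hg⟩ := hg
  obtain ⟨h1, h2⟩ := hg k hk
  obtain ⟨p0, p1, p2, p3⟩ := hP
  refine .step p0 (.step p1 (.step p2 (.step p3 ?_)))
  subst hwa
  simp only [Instr.exec, Function.update_self, Function.update_idem, Nat.mod_eq_of_lt hf,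
    List.getD_eq_getElem?_getD, hb, Option.getD_some, WordOp.eval, Function.update_of_ne ha,
    Nat.mod_eq_of_lt h1, h2]
  exact h _

theorem Runs.min {p : ℕ} {w : ℕ → ℕ} {r : ℕ → ℝ} {oW : List ℕ} {oR : List ℝ} {u v : ℕ}
    (hP : P[p]? = some (.jumpLt u v (p + 2)) ∧ P[p + 1]? = some (.move u v))
    (h : Runs P D b T ⟨p + 2, Function.update w u (min (w u) (w v)), r, oW, oR⟩ Q) :
    Runs P D b (T + 2) ⟨p, w, r, oW, oR⟩ Q := by
  by_cases hlt : w u < w v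
  · rw [min_eq_left hlt.le, Function.update_eq_self] at h
    refine .mono (Nat.le_succ _) (.step hP.1 ?_)
    simpa only [Instr.exec, hlt, if_true] using h
  · rw [min_eq_right (not_lt.mp hlt)] at h
    refine .step (T := T + 1) hP.1 ?_
    simp only [Instr.exec, hlt, if_false]
    exact .step hP.2 h

end Runs

/-! ## Range minimum queries -/

section RangeMin

/-- The least value of `a` on the numbers below `n` satisfying `p`, and `n` if there is none. -/
def rangeMin (n : ℕ) (a : ℕ → ℕ) (p : ℕ → Prop) [DecidablePred p] : ℕ :=
  ((Finset.range n).filter p).fold min n a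

theorem le_rangeMin {n : ℕ} {a : ℕ → ℕ} {p : ℕ → Prop} [DecidablePred p] {c : ℕ} :
    c ≤ rangeMin n a p ↔ c ≤ n ∧ ∀ k < n, p k → c ≤ a k := by
  simp [rangeMin, Finset.le_fold_min]

theorem rangeMin_le (n : ℕ) (a : ℕ → ℕ) (p : ℕ → Prop) [DecidablePred p] :
    rangeMin n a p ≤ n := (le_rangeMin.mp le_rfl).1

/-- Bit `t` tells whether `a` is less at position `t` of the block of `j` than at all later
positions up to `j`. -/
def stackMask (B : ℕ) (a : ℕ → ℕ) (j : ℕ) : ℕ :=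
  Nat.ofBits fun t : Fin B =>
    decide (j / B * B + t ≤ j ∧ ∀ k ≤ j, j / B * B + t < k → a (j / B * B + t) < a k)

/-- The position of the lowest bit. -/
noncomputable def lowBit (m : ℕ) : ℕ := sInf {t | m.testBit t = true}

/-- The tables used for range minimum queries on the array `a`. -/
structure RangeMinTables (D : DataStruct) (b n : ℕ) (pos a : ℕ → ℕ) : Prop where
  pos : FnTable D b 2 n pos
  blk : FnTable D b 3 n (· / n.size)
  suf : FnTable D b 4 n fun i => rangeMin n a fun k => i < k ∧ k / n.size = i / n.size
  pre : FnTable D b 5 n fun j => rangeMin n a fun k => k ≤ j ∧ k / n.size = j / n.size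
  row : FnTable D b 6 (n / n.size + 1) fun d => Nat.log 2 d * (n / n.size + 1)
  fwd : FnTable D b 7 (n.size * (n / n.size + 1)) fun x => rangeMin n a fun k =>
    x % (n / n.size + 1) < k / n.size ∧
      k / n.size < x % (n / n.size + 1) + 2 ^ (x / (n / n.size + 1))
  bwd : FnTable D b 8 (n.size * (n / n.size + 1)) fun x => rangeMin n a fun k =>
    k / n.size < x % (n / n.size + 1) ∧
      x % (n / n.size + 1) < k / n.size + 2 ^ (x / (n / n.size + 1))
  mask : FnTable D b 9 n (stackMask n.size a)
  offs : FnTable D b 10 n fun i => i % n.size + 1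
  low : FnTable D b 11 (2 ^ n.size) fun m => lowBit m + 1
  val : FnTable D b 12 n a

/-- Shifting by i % B + 1 discards the positions up to i, so bit t now describes position i + 1 + t.
-/
theorem stackMask_shift_testBit {B : ℕ} (hB : 0 < B) {a : ℕ → ℕ} {i j t : ℕ}
    (hblk : i / B = j / B) :
    (stackMask B a j >>> (i % B + 1)).testBit t = true ↔
      i + t + 1 ≤ j ∧ ∀ k ≤ j, i + t + 1 < k → a (i + t + 1) < a k := by
  have hi : j / B * B + (i % B + 1 + t) = i + t + 1 := by
    rw [← hblk]
    have := Nat.div_add_mod' i B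
    omega
  rw [Nat.testBit_shiftRight, stackMask, Nat.testBit_ofBits]
  split_ifs with h
  · rw [decide_eq_true_iff]
    simp only [hi]
  · simp only [false_iff]
    rintro ⟨h1, -⟩
    have h2 := Nat.div_add_mod' j B
    have h3 := Nat.mod_lt j hB
    omega

/-- Within a block the mask yields the position of the minimum. -/
theorem lowBit_stackMask {B : ℕ} (hB : 0 < B) {a : ℕ → ℕ} {i j : ℕ} (hij : i < j)
    (hblk : i / B = j / B) {k : ℕ}
    (hk : k = i + (lowBit (stackMask B a j >>> (i % B + 1)) + 1)) :
    i < k ∧ k ≤ j ∧ ∀ k', i < k' → k' ≤ j → a k ≤ a k' := by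
  set M := stackMask B a j >>> (i % B + 1)
  have hbit : ∀ t, M.testBit t = true ↔ _ := fun t => stackMask_shift_testBit hB hblk
  have hne : {t | M.testBit t = true}.Nonempty := by
    -- The bit of j itself is set, since no later position competes.
    refine ⟨j - i - 1, (hbit _).mpr ⟨by omega, fun k h1 h2 => by omega⟩⟩
  obtain ⟨h1, h2⟩ := (hbit _).mp (Nat.sInf_mem hne)
  change i + lowBit M + 1 ≤ j at h1
  rw [show i + sInf {t | M.testBit t = true} + 1 = k by rw [hk]; rfl] at h2
  refine ⟨by omega, by omega, fun k' hk1 hk2 => ?_⟩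
  rcases lt_trichotomy k k' with h | rfl | h
  · exact (h2 k' hk2 h).le
  · exact le_rfl
  · by_contra hlt
    -- If k were not minimal, the last position q of the least value would have its bit set and
    -- precede k. The key (a q, j - q) selects the last among equal values.
    obtain ⟨q, hq, hqmin⟩ := Finset.exists_min_image ((Finset.Ioc i j).filter (a · < a k))
      (fun q => toLex (a q, j - q))
      ⟨k', by simp only [Finset.mem_filter, Finset.mem_Ioc]; omega⟩
    simp only [Finset.mem_filter, Finset.mem_Ioc] at hq hqmin
    have hqk : q < k := by
      by_contra hc
      rcases (not_lt.mp hc).eq_or_lt with rfl | hc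
      · omega
      · have := h2 q hq.1.2 hc
        omega
    have hmem : M.testBit (q - i - 1) = true := by
      refine (hbit _).mpr ?_
      rw [show i + (q - i - 1) + 1 = q by omega]
      refine ⟨hq.1.2, fun z hz hqz => ?_⟩
      by_contra hc
      have := hqmin z ⟨⟨by omega, hz⟩, by omega⟩
      rw [Prod.Lex.toLex_le_toLex] at this
      simp only at this
      omega
    have : lowBit M ≤ q - i - 1 := Nat.sInf_le hmem
    omega

/-- Across blocks the four tables yield the minimum. -/
theorem min_tables {n B N : ℕ} {a : ℕ → ℕ} (ha : ∀ k, 0 < k → k < n → a k < n)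
    {i j m : ℕ} (hij : i < j) (hjn : j < n) (hlt : i / B < j / B) (hN : j / B < N)
    (hm : m = min (min (min
      (rangeMin n a fun k => i < k ∧ k / B = i / B) (rangeMin n a fun k => k ≤ j ∧ k / B = j / B))
      (rangeMin n a fun k => (Nat.log 2 (j / B - i / B) * N + i / B) % N < k / B ∧
        k / B < (Nat.log 2 (j / B - i / B) * N + i / B) % N +
          2 ^ ((Nat.log 2 (j / B - i / B) * N + i / B) / N)))
      (rangeMin n a fun k => k / B < (Nat.log 2 (j / B - i / B) * N + j / B) % N ∧
        (Nat.log 2 (j / B - i / B) * N + j / B) % N < k / B +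
          2 ^ ((Nat.log 2 (j / B - i / B) * N + j / B) / N))) :
    ∃ k, i < k ∧ k ≤ j ∧ m = a k ∧ ∀ k', i < k' → k' ≤ j → a k ≤ a k' := by
  have h1 : ∀ q < N, (Nat.log 2 (j / B - i / B) * N + q) % N = q := fun q hq => by
    rw [Nat.mul_add_mod_self_right, Nat.mod_eq_of_lt hq]
  have h2 : ∀ q < N, (Nat.log 2 (j / B - i / B) * N + q) / N = Nat.log 2 (j / B - i / B) :=
    fun q hq => by
      rw [mul_comm, Nat.mul_add_div (by omega), Nat.div_eq_of_lt hq, add_zero]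
  rw [h1 _ hN, h2 _ hN, h1 _ (hlt.trans hN), h2 _ (hlt.trans hN)] at hm
  -- With L the largest power of two at most the block distance, windows of length L forward from
  -- the first block and backward from the last stay within range, and together cover all blocks
  -- strictly between.
  have hlow : 2 ^ Nat.log 2 (j / B - i / B) ≤ j / B - i / B := Nat.pow_log_le_self 2 (by omega)
  have hhigh : j / B - i / B < 2 ^ Nat.log 2 (j / B - i / B) * 2 :=
    Nat.lt_pow_succ_log_self one_lt_two _
  generalize 2 ^ Nat.log 2 (j / B - i / B) = L at hm hlow hhigh
  have key : ∀ c, c ≤ m ↔ c ≤ n ∧ ∀ k, i < k → k ≤ j → c ≤ a k := by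
    intro c
    rw [hm]
    simp only [le_min_iff, le_rangeMin]
    constructor
    · rintro ⟨⟨⟨⟨h0, g1⟩, -, g2⟩, -, g3⟩, -, g4⟩
      refine ⟨h0, fun k hk1 hk2 => ?_⟩
      have b1 : i / B ≤ k / B := Nat.div_le_div_right hk1.le
      have b2 : k / B ≤ j / B := Nat.div_le_div_right hk2
      by_cases e1 : k / B = i / B
      · exact g1 k (by omega) ⟨hk1, e1⟩
      by_cases e2 : k / B = j / B
      · exact g2 k (by omega) ⟨hk2, e2⟩
      by_cases e3 : k / B < i / B + L
      · exact g3 k (by omega) ⟨by omega, e3⟩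
      · exact g4 k (by omega) ⟨by omega, by omega⟩
    · rintro ⟨h0, g⟩
      have up : ∀ k, i / B < k / B → i < k := fun k h => by
        by_contra hc
        have : k / B ≤ i / B := Nat.div_le_div_right (not_lt.mp hc)
        omega
      have lo : ∀ k, k / B < j / B → k ≤ j := fun k h => by
        by_contra hc
        have : j / B ≤ k / B := Nat.div_le_div_right (not_le.mp hc).le
        omega
      refine ⟨⟨⟨⟨h0, fun k _ hk => g k hk.1 (lo k (by omega))⟩,
        h0, fun k _ hk => g k (up k (by omega)) hk.1⟩,
        h0, fun k _ hk => g k (up k (by omega)) (lo k (by omega))⟩,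
        h0, fun k _ hk => g k (up k (by omega)) (lo k (by omega))⟩
  obtain ⟨k, hk, hmin⟩ := Finset.exists_min_image (Finset.Ioc i j) a ⟨j, by simpa⟩
  simp only [Finset.mem_Ioc] at hk hmin
  refine ⟨k, hk.1, hk.2, eq_of_forall_le_iff fun c => ?_, fun k' h1 h2 => hmin k' ⟨h1, h2⟩⟩
  rw [key]
  -- Ranks in range are below n, so the value n returned by `rangeMin` on an empty set never wins.
  have := ha k (by omega) (by omega)
  exact ⟨fun h => h.2 k hk.1 hk.2, fun h => ⟨by omega, fun k' h1 h2 => h.trans (hmin k' ⟨h1, h2⟩)⟩⟩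

/-- The query program: it leaves the minimum over the gaps between the positions of the two
vertices in register `7`. -/
def rangeMinProg : List Instr :=
  lookup 2 3 0 ++ lookup 2 4 1 ++
  [.jumpLt 3 4 12, .move 5 3, .move 3 4, .move 4 5] ++
  lookup 3 5 3 ++ lookup 3 6 4 ++ [.jumpEq 5 6 51] ++
  lookup 4 7 3 ++ lookup 5 8 4 ++ [.jumpLt 7 8 31, .move 7 8, .op .sub 9 6 5] ++
  lookup 6 9 9 ++ [.op .add 10 9 5] ++ lookup 7 8 10 ++ [.jumpLt 7 8 43, .move 7 8, .op .add 10 9 6] ++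
  lookup 8 8 10 ++ [.jumpLt 7 8 50, .move 7 8, .jump 69] ++
  lookup 9 7 4 ++ lookup 10 8 3 ++ [.op .shr 7 7 8] ++ lookup 11 7 7 ++ [.op .add 7 7 3] ++
  lookup 12 7 7

variable {D : DataStruct} {b n : ℕ} {pos a : ℕ → ℕ} {rest : List Instr}

/-- Symbolic execution of the two branches: positions in one block are handled by mask and lowest
bit, positions in different blocks by the four minima. The code `rest` stays arbitrary so that both
query programs can share this prefix. -/
theorem rangeMinProg_runs_ordered (hD : RangeMinTables D b n pos a) (hb : 16 ≤ 2 ^ b)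
    (ha : ∀ k, 0 < k → k < n → a k < n) {i j : ℕ} (hij : i < j) (hjn : j < n) (w : ℕ → ℕ)
    (r : ℕ → ℝ) (h3 : w 3 = i) (h4 : w 4 = j) :
    Runs (rangeMinProg ++ rest) D b 60 ⟨12, w, r, [], []⟩ fun c =>
      c.pc = 69 ∧ c.rreg = r ∧ c.outW = [] ∧ c.outR = [] ∧
      ∃ k, i < k ∧ k ≤ j ∧ c.wreg 7 = a k ∧ ∀ k', i < k' → k' ≤ j → a k ≤ a k' := by
  have hin : i < n := hij.trans hjn
  have hB : 0 < n.size := Nat.size_pos.mpr (by omega)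
  have hN : ∀ {q}, q < n → q / n.size < n / n.size + 1 := fun h =>
    Nat.lt_succ_of_le (Nat.div_le_div_right h.le)
  have hbij : i / n.size ≤ j / n.size := Nat.div_le_div_right hij.le
  refine .mono (T := 52 + 4 + 4) (by norm_num) ?_
  refine .lookup ⟨rfl, rfl, rfl, rfl⟩ (by omega) (by decide) hD.blk h3 hin fun z1 => ?_
  refine .lookup ⟨rfl, rfl, rfl, rfl⟩ (by omega) (by decide) hD.blk (k := j) (by simp [h4]) hjn
    fun z2 => ?_
  refine .step (T := 51) rfl ?_
  by_cases hblk : i / n.size = j / n.size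
  · simp only [Instr.exec]
    rw [if_pos (by simpa using hblk)]
    refine .lookup (T := 47) ⟨rfl, rfl, rfl, rfl⟩ (by omega) (by decide) hD.mask (k := j) (by simp [h4])
      hjn fun z3 => ?_
    refine .lookup (T := 43) ⟨rfl, rfl, rfl, rfl⟩ (by omega) (by decide) hD.offs (k := i) (by simp [h3])
      hin fun z4 => ?_
    refine .step (T := 42) rfl ?_
    have hlt : stackMask n.size a j >>> (i % n.size + 1) < 2 ^ n.size := by
      exact (Nat.shiftRight_le _ _).trans_lt (Nat.ofBits_lt_two_pow _)
    refine .lookup (T := 38) ⟨rfl, rfl, rfl, rfl⟩ (by omega) (by decide) hD.low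
      (k := stackMask n.size a j >>> (i % n.size + 1))
      (by simp [WordOp.eval, Nat.mod_eq_of_lt (hD.low.lt hlt)]) hlt fun z5 => ?_
    refine .step (T := 37) rfl ?_
    obtain ⟨g1, g2, g3⟩ := lowBit_stackMask hB hij hblk (a := a) rfl
    generalize hk : i + (lowBit (stackMask n.size a j >>> (i % n.size + 1)) + 1) = k at g1 g2 g3
    have hkn : k < n := by omega
    refine .lookup (T := 33) ⟨rfl, rfl, rfl, rfl⟩ (by omega) (by decide) hD.val
      (k := k) ?_ hkn fun z6 => ?_
    · simp [WordOp.eval, h3]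
      rw [Nat.mod_eq_of_lt] <;> have := hD.val.lt hkn <;> omega
    · exact .of ⟨rfl, rfl, rfl, rfl, k, g1, g2, by simp, g3⟩
  · have hlt : i / n.size < j / n.size := by omega
    simp only [Instr.exec]
    rw [if_neg (by simpa using hblk)]
    refine .lookup (T := 47) ⟨rfl, rfl, rfl, rfl⟩ (by omega) (by decide) hD.suf (k := i) (by simp [h3])
      hin fun z3 => ?_
    refine .lookup (T := 43) ⟨rfl, rfl, rfl, rfl⟩ (by omega) (by decide) hD.pre (k := j) (by simp [h4])
      hjn fun z4 => ?_
    refine .min (T := 41) ⟨rfl, rfl⟩ ?_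
    refine .step (T := 40) rfl ?_
    have hd : j / n.size - i / n.size < n / n.size + 1 :=
      (Nat.sub_le _ _).trans_lt (hN hjn)
    refine .lookup (T := 36) ⟨rfl, rfl, rfl, rfl⟩ (by omega) (by decide) hD.row
      (k := j / n.size - i / n.size) ?_ hd fun z5 => ?_
    · have h1 := hD.row.lt hd
      have h2 := hD.row.lt (hN hin)
      simp only [WordOp.eval]
      simp
      -- Machine subtraction adds the complement modulo 2^b; one wrap leaves the true difference.
      rw [show j / n.size + (2 ^ b - i / n.size) = j / n.size - i / n.size + 2 ^ b by omega,
        Nat.add_mod_right, Nat.mod_eq_of_lt h1]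
    have hlog : Nat.log 2 (j / n.size - i / n.size) + 1 ≤ n.size := by
      exact Nat.log_lt_of_lt_pow (Nat.sub_pos_of_lt hlt).ne'
        ((((Nat.sub_le _ _).trans (Nat.div_le_self _ _)).trans_lt hjn).trans n.lt_size_self)
    have hidx : ∀ q < n / n.size + 1, Nat.log 2 (j / n.size - i / n.size) * (n / n.size + 1) + q <
        n.size * (n / n.size + 1) := fun q hq =>
      calc _ < (Nat.log 2 (j / n.size - i / n.size) + 1) * (n / n.size + 1) := by
            rw [Nat.succ_mul]; omega
        _ ≤ _ := Nat.mul_le_mul_right _ hlog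
    refine .step (T := 35) rfl ?_
    refine .lookup (T := 31) ⟨rfl, rfl, rfl, rfl⟩ (by omega) (by decide) hD.fwd
      (k := Nat.log 2 (j / n.size - i / n.size) * (n / n.size + 1) + i / n.size) ?_
      (hidx _ (hN hin)) fun z6 => ?_
    · simp [WordOp.eval]
      exact Nat.mod_eq_of_lt (hD.fwd.lt (hidx _ (hN hin)))
    refine .min (T := 29) ⟨rfl, rfl⟩ ?_
    refine .step (T := 28) rfl ?_
    refine .lookup (T := 24) ⟨rfl, rfl, rfl, rfl⟩ (by omega) (by decide) hD.bwd
      (k := Nat.log 2 (j / n.size - i / n.size) * (n / n.size + 1) + j / n.size) ?_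
      (hidx _ (hN hjn)) fun z7 => ?_
    · simp [WordOp.eval]
      exact Nat.mod_eq_of_lt (hD.bwd.lt (hidx _ (hN hjn)))
    refine .min (T := 22) ⟨rfl, rfl⟩ ?_
    refine .step (T := 21) rfl ?_
    obtain ⟨k, g1, g2, g3, g4⟩ := min_tables ha hij hjn hlt (hN hjn) rfl
    refine .of ⟨rfl, rfl, rfl, rfl, k, g1, g2, ?_, g4⟩
    rw [← g3]
    simp [Instr.exec]

theorem rangeMinProg_runs (hD : RangeMinTables D b n pos a) (hb : 16 ≤ 2 ^ b)
    (ha : ∀ k, 0 < k → k < n → a k < n) (x y : Fin n) (hxy : pos x ≠ pos y) (hx : pos x < n)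
    (hy : pos y < n) (Δ : ℝ) :
    Runs (rangeMinProg ++ rest) D b 80 (initConfig b x y Δ) fun c =>
      c.pc = 69 ∧ c.rreg 0 = Δ ∧ c.outW = [] ∧ c.outR = [] ∧
      ∃ k, min (pos x) (pos y) < k ∧ k ≤ max (pos x) (pos y) ∧ c.wreg 7 = a k ∧
        ∀ k', min (pos x) (pos y) < k' → k' ≤ max (pos x) (pos y) → a k ≤ a k' := by
  refine .lookup (T := 76) ⟨rfl, rfl, rfl, rfl⟩ (by omega) (by decide) hD.pos (k := x)
    (by simp [Nat.mod_eq_of_lt (hD.pos.lt x.2)]) x.2 fun z1 => ?_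
  refine .lookup (T := 72) ⟨rfl, rfl, rfl, rfl⟩ (by omega) (by decide) hD.pos (k := y)
    (by simp [Nat.mod_eq_of_lt (hD.pos.lt y.2)]) y.2 fun z2 => ?_
  refine .step (T := 71) rfl ?_
  rcases lt_or_gt_of_ne hxy with h | h
  · simp only [Instr.exec]
    rw [if_pos (by simpa using h), min_eq_left h.le, max_eq_right h.le]
    refine .mono (T := 60 + 0) (by norm_num) ((rangeMinProg_runs_ordered hD hb ha h hy _ _ (by simp) (by simp)).bind ?_)
    rintro c ⟨h1, h2, h3⟩
    exact .of ⟨h1, by rw [h2]; simp, h3⟩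
  · simp only [Instr.exec]
    rw [if_neg (by simpa using h.le), min_eq_right h.le, max_eq_left h.le]
    refine .step (T := 70) rfl (.step (T := 69) rfl (.step (T := 68) rfl ?_))
    refine .mono (T := 60 + 0) (by norm_num)
      ((rangeMinProg_runs_ordered hD hb ha h hx _ _ (by simp [Instr.exec]) (by simp [Instr.exec])).bind ?_)
    rintro c ⟨h1, h2, h3⟩
    exact .of ⟨h1, by rw [h2]; simp [Instr.exec], h3⟩

end RangeMin

/-! ## The two query programs -/

/-- The program reporting the capacity after the query. -/
def capProg : List Instr :=
  rangeMinProg ++ [.rload 1 7, .rsub 1 1 0, .const 2 0, .rload 2 2, .rjumpLt 1 2 75, .rmove 1 2,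
    .remit 1]

/-- The program listing a cut. -/
def cutProg : List Instr :=
  rangeMinProg ++ ([.rload 1 7, .rsub 1 1 0, .const 2 0, .rload 2 2, .rjumpLt 1 2 75, .const 7 0] ++
    lookup 0 8 7 ++ lookup 1 9 7 ++ [.const 11 1, .jumpEq 8 9 92] ++ lookup 13 10 8 ++
    [.emit 10, .op .add 8 8 11, .jump 84])

section Programs

variable {D : DataStruct} {b n : ℕ} {pos a : ℕ → ℕ}

/-- The rank left in register 7 addresses the real cell of the best cut. Real cell 0 is reserved for
`lam`, and the last comparison outputs the minimum. -/
theorem capProg_answers (hD : RangeMinTables D b n pos a) (hb : 16 ≤ 2 ^ b)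
    (ha : ∀ k, 0 < k → k < n → a k < n) (x y : Fin n) (hxy : pos x ≠ pos y) (hx : pos x < n)
    (hy : pos y < n) (Δ : ℝ) {lam : ℝ} (hlam : D.reals[0]? = some lam) :
    ∃ k, min (pos x) (pos y) < k ∧ k ≤ max (pos x) (pos y) ∧
      (∀ k', min (pos x) (pos y) < k' → k' ≤ max (pos x) (pos y) → a k ≤ a k') ∧
      ∀ μ, D.reals[a k]? = some μ →
        Answers capProg D b x y Δ 100 [] [min lam (μ - Δ)] := by
  obtain ⟨t, ht, hpc, hr, hoW, hoR, k, hk1, hk2, hk3, hk4⟩ := rangeMinProg_runs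
    (rest := [.rload 1 7, .rsub 1 1 0, .const 2 0, .rload 2 2, .rjumpLt 1 2 75, .rmove 1 2,
    .remit 1]) hD hb ha x y hxy hx hy Δ
  refine ⟨k, hk1, hk2, hk4, fun μ hμ => ?_⟩
  have h2 : Runs capProg D b 20 ((step capProg D b)^[t] (initConfig b x y Δ)) fun c =>
      76 ≤ c.pc ∧ c.outW = [] ∧ c.outR = [min lam (μ - Δ)] := by
    change ((step capProg D b)^[t] (initConfig b x y Δ)).pc = 69 at hpc
    change ((step capProg D b)^[t] (initConfig b x y Δ)).rreg 0 = Δ at hr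
    change ((step capProg D b)^[t] (initConfig b x y Δ)).outW = [] at hoW
    change ((step capProg D b)^[t] (initConfig b x y Δ)).outR = [] at hoR
    change ((step capProg D b)^[t] (initConfig b x y Δ)).wreg 7 = a k at hk3
    generalize (step capProg D b)^[t] (initConfig b x y Δ) = c at *
    obtain ⟨pc, w, r, oW, oR⟩ := c
    simp only at hpc hr hoW hoR hk3
    subst hpc hoW hoR
    refine .step (T := 19) rfl (.step (T := 18) rfl (.step (T := 17) rfl (.step (T := 16) rfl
      (.step (T := 15) rfl ?_))))
    simp only [Instr.exec, Function.update_self, Nat.zero_mod, hk3, List.getD_eq_getElem?_getD, hμ,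
      hlam, Option.getD_some, hr, ne_eq, OfNat.one_ne_ofNat,
      not_false_eq_true, Function.update_of_ne, zero_ne_one]
    by_cases hlt : μ - Δ < lam
    · rw [if_pos hlt, min_eq_right hlt.le]
      refine .step (T := 14) rfl (.of ⟨le_rfl, rfl, ?_⟩)
      simp [Instr.exec]
    · rw [if_neg hlt, min_eq_left (not_lt.mp hlt)]
      refine .step (T := 14) rfl (.step (T := 13) rfl (.of ⟨le_rfl, rfl, ?_⟩))
      simp [Instr.exec]
  obtain ⟨t', ht', hpc', hW, hR⟩ := h2
  exact ⟨t' + t, by omega, _, rfl, by rw [Function.iterate_add_apply]; exact hpc',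
    by rw [Function.iterate_add_apply]; exact hW, by rw [Function.iterate_add_apply]; exact hR⟩

/-- Registers 8 and 9 hold the current and final addresses and register 11 the increment. Each
vertex costs 8 instructions, and the closing test costs one more. -/
theorem cutProg_loop {N : ℕ} {g : ℕ → ℕ} (hD : FnTable D b 13 N g) (hb : 16 ≤ 2 ^ b)
    (hN : N < 2 ^ b) (l : List ℕ) (s e : ℕ) (he : s + l.length = e) (heN : e ≤ N)
    (hl : ∀ q v, l[q]? = some v → g (s + q) = v) (w : ℕ → ℕ) (r : ℕ → ℝ) (oW : List ℕ)
    (h8 : w 8 = s) (h9 : w 9 = e) (h11 : w 11 = 1) :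
    Runs cutProg D b (1 + 8 * l.length) ⟨84, w, r, oW, []⟩ fun c =>
      92 ≤ c.pc ∧ c.outW = oW ++ l ∧ c.outR = [] := by
  induction l generalizing s w oW with
  | nil =>
    refine .step rfl (.of ⟨?_, by simp [Instr.exec], rfl⟩)
    simp only [List.length_nil, Nat.add_zero] at he
    simp [Instr.exec, h8, h9, he]
  | cons v l ih =>
    simp only [List.length_cons] at he
    refine .mono (T := 1 + 8 * l.length + 1 + 1 + 1 + 4 + 1) (by simp; omega) (.step rfl ?_)
    simp only [Instr.exec]
    rw [if_neg (by omega)]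
    refine .lookup ⟨rfl, rfl, rfl, rfl⟩ (by omega) (by decide) hD h8 (by omega) fun z => ?_
    refine .step rfl (.step rfl (.step rfl ?_))
    have h0 : g s = v := hl 0 v rfl
    have := ih (s + 1) (by omega) (fun q u hq => by
      rw [show s + 1 + q = s + (q + 1) by omega]; exact hl (q + 1) u (by simpa using hq))
      (Function.update (Function.update (Function.update w 2 z) 10 (g s)) 8 (s + 1)) (oW ++ [v])
      (by simp) (by simp [h9]) (by simp [h11])
    simpa [Instr.exec, WordOp.eval, h8, h11, Nat.mod_eq_of_lt (show s + 1 < 2 ^ b by omega), h0]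
      using this

theorem cutProg_answers (hD : RangeMinTables D b n pos a) (hb : 16 ≤ 2 ^ b)
    (ha : ∀ k, 0 < k → k < n → a k < n) (x y : Fin n) (hxy : pos x ≠ pos y) (hx : pos x < n)
    (hy : pos y < n) (Δ : ℝ) {lam : ℝ} (hlam : D.reals[0]? = some lam) {fst lst g : ℕ → ℕ}
    {N : ℕ} (hfst : FnTable D b 0 n fst) (hlst : FnTable D b 1 n lst) (hg : FnTable D b 13 N g)
    (hN : N < 2 ^ b) :
    ∃ k, min (pos x) (pos y) < k ∧ k ≤ max (pos x) (pos y) ∧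
      (∀ k', min (pos x) (pos y) < k' → k' ≤ max (pos x) (pos y) → a k ≤ a k') ∧
      ∀ μ, D.reals[a k]? = some μ → ∀ (l : List ℕ) (m : ℕ), m = (if μ - Δ < lam then a k else 0) →
        fst m + l.length = lst m → lst m ≤ N → (∀ q v, l[q]? = some v → g (fst m + q) = v) →
        Answers cutProg D b x y Δ (120 + 8 * l.length) l [] := by
  obtain ⟨t, ht, hpc, hr, hoW, hoR, k, hk1, hk2, hk3, hk4⟩ := rangeMinProg_runs
    (rest := ([.rload 1 7, .rsub 1 1 0, .const 2 0, .rload 2 2, .rjumpLt 1 2 75, .const 7 0] ++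
    lookup 0 8 7 ++ lookup 1 9 7 ++ [.const 11 1, .jumpEq 8 9 92] ++ lookup 13 10 8 ++
    [.emit 10, .op .add 8 8 11, .jump 84])) hD hb ha x y hxy hx hy Δ
  refine ⟨k, hk1, hk2, hk4, fun μ hμ l m hm hlen hlN hl => ?_⟩
  have hmn : m < n := by
    have := ha k (by omega) (by omega)
    split_ifs at hm <;> omega
  have tail : ∀ (w : ℕ → ℕ) (r : ℕ → ℝ), w 7 = m →
      Runs cutProg D b (1 + 8 * l.length + 1 + 4 + 4) ⟨75, w, r, [], []⟩ fun c =>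
        92 ≤ c.pc ∧ c.outW = l ∧ c.outR = [] := by
    intro w r hw
    refine .lookup ⟨rfl, rfl, rfl, rfl⟩ (by omega) (by decide) hfst hw hmn fun z1 => ?_
    refine .lookup ⟨rfl, rfl, rfl, rfl⟩ (by omega) (by decide) hlst (k := m) (by simp [hw]) hmn
      fun z2 => ?_
    refine .step rfl ?_
    have h1 : 1 % 2 ^ b = 1 := Nat.mod_eq_of_lt (by omega)
    exact cutProg_loop hg hb hN l (fst m) (lst m) hlen hlN hl _ r [] (by simp) (by simp) (by simp [h1])
  have h2 : Runs cutProg D b (30 + 8 * l.length)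
      ((step cutProg D b)^[t] (initConfig b x y Δ)) fun c =>
      92 ≤ c.pc ∧ c.outW = l ∧ c.outR = [] := by
    change ((step cutProg D b)^[t] (initConfig b x y Δ)).pc = 69 at hpc
    change ((step cutProg D b)^[t] (initConfig b x y Δ)).rreg 0 = Δ at hr
    change ((step cutProg D b)^[t] (initConfig b x y Δ)).outW = [] at hoW
    change ((step cutProg D b)^[t] (initConfig b x y Δ)).outR = [] at hoR
    change ((step cutProg D b)^[t] (initConfig b x y Δ)).wreg 7 = a k at hk3
    generalize (step cutProg D b)^[t] (initConfig b x y Δ) = c at *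
    obtain ⟨pc, w, r, oW, oR⟩ := c
    simp only at hpc hr hoW hoR hk3
    subst hpc hoW hoR
    refine .mono (T := 1 + 8 * l.length + 1 + 4 + 4 + 1 + 1 + 1 + 1 + 1 + 1) (by omega) ?_
    refine .step rfl (.step rfl (.step rfl (.step rfl (.step rfl ?_))))
    simp only [Instr.exec, Function.update_self, Nat.zero_mod, hk3, List.getD_eq_getElem?_getD, hμ,
      hlam, Option.getD_some, hr, ne_eq, OfNat.one_ne_ofNat,
      not_false_eq_true, Function.update_of_ne, zero_ne_one]
    by_cases hlt : μ - Δ < lam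
    · rw [if_pos hlt] at hm ⊢
      exact .mono (by omega) (tail _ _ (by simp [hk3, hm]))
    · rw [if_neg hlt] at hm ⊢
      exact .step rfl (tail _ _ (by simp [hm]))
  obtain ⟨t', ht', hpc', hW, hR⟩ := h2
  exact ⟨t' + t, by omega, _, rfl, by rw [Function.iterate_add_apply]; exact hpc',
    by rw [Function.iterate_add_apply]; exact hW, by rw [Function.iterate_add_apply]; exact hR⟩

end Programs

/-! ## The tables of the data structures -/

theorem FnTable.of_packTables {tabs : List (List ℕ)} {rs : List ℝ} {b f N : ℕ} {g : ℕ → ℕ}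
    (hf : tabs[f]? = some ((List.range N).map g)) (hb : (packTables tabs).length ≤ 2 ^ b) :
    FnTable ⟨packTables tabs, rs⟩ b f N g := by
  refine ⟨tableBase tabs f, packTables_pointer (List.getElem?_eq_some_iff.mp hf).1, fun k hk => ?_⟩
  have h := packTables_entry hf (k := k) (v := g k) (by simp [hk])
  exact ⟨(List.getElem?_eq_some_iff.mp h).1.trans_le hb, h⟩

/-- The tables for range minimum queries. -/
noncomputable def rangeMinTabs (n : ℕ) (pos a : ℕ → ℕ) : List (List ℕ) :=
  [(List.range n).map pos,
    (List.range n).map (· / n.size),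
    (List.range n).map fun i => rangeMin n a fun k => i < k ∧ k / n.size = i / n.size,
    (List.range n).map fun j => rangeMin n a fun k => k ≤ j ∧ k / n.size = j / n.size,
    (List.range (n / n.size + 1)).map fun d => Nat.log 2 d * (n / n.size + 1),
    (List.range (n.size * (n / n.size + 1))).map fun x => rangeMin n a fun k =>
      x % (n / n.size + 1) < k / n.size ∧
        k / n.size < x % (n / n.size + 1) + 2 ^ (x / (n / n.size + 1)),
    (List.range (n.size * (n / n.size + 1))).map fun x => rangeMin n a fun k =>
      k / n.size < x % (n / n.size + 1) ∧
        x % (n / n.size + 1) < k / n.size + 2 ^ (x / (n / n.size + 1)),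
    (List.range n).map (stackMask n.size a),
    (List.range n).map fun i => i % n.size + 1,
    (List.range (2 ^ n.size)).map fun m => lowBit m + 1,
    (List.range n).map a]

theorem rangeMinTables_of_packTables {n b : ℕ} {pos a : ℕ → ℕ} {t₀ t₁ : List ℕ}
    {rest : List (List ℕ)} {rs : List ℝ}
    (hb : (packTables (t₀ :: t₁ :: (rangeMinTabs n pos a ++ rest))).length ≤ 2 ^ b) :
    RangeMinTables ⟨packTables (t₀ :: t₁ :: (rangeMinTabs n pos a ++ rest)), rs⟩ b n pos a where
  pos := .of_packTables rfl hb
  blk := .of_packTables rfl hb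
  suf := .of_packTables rfl hb
  pre := .of_packTables rfl hb
  row := .of_packTables rfl hb
  fwd := .of_packTables rfl hb
  bwd := .of_packTables rfl hb
  mask := .of_packTables rfl hb
  offs := .of_packTables rfl hb
  low := .of_packTables rfl hb
  val := .of_packTables rfl hb

/-! ### Linear table sizes and logarithmic word length -/

section Sizes

variable {n : ℕ}

theorem two_pow_size_le (hn : 0 < n) : 2 ^ n.size ≤ 2 * n := by
  have h : 0 < n.size := Nat.size_pos.mpr hn
  have h2 : 2 ^ (n.size - 1) ≤ n := Nat.lt_size.mp (by omega)
  calc 2 ^ n.size = 2 ^ (n.size - 1 + 1) := by rw [Nat.sub_add_cancel h]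
    _ ≤ 2 * n := by rw [pow_succ]; omega

theorem size_le_self (n : ℕ) : n.size ≤ n := Nat.size_le.mpr Nat.lt_two_pow_self

/-- The sparse tables have about log n rows over n / log n blocks, which is why they occupy linear
space. -/
theorem size_mul_blocks_le (n : ℕ) : n.size * (n / n.size + 1) ≤ 2 * n := by
  have h1 := Nat.mul_div_le n n.size
  have h2 := size_le_self n
  rw [Nat.mul_succ]
  omega

theorem blocks_le (hn : 2 ≤ n) : n / n.size + 1 ≤ n := by
  have h : 2 ≤ n.size := Nat.lt_size.mpr (by simpa using hn)
  have h1 : n / n.size ≤ n / 2 := Nat.div_le_div_left h (by norm_num)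
  omega

/-- Words must address up to order n² cells, because the store of cuts can be that long. -/
theorem word_size_bound (hn : 2 ≤ n) : 65536 * (n * n) < 2 ^ (10 * n.size) := by
  have h : 2 ≤ n.size := Nat.lt_size.mpr (by simpa using hn)
  have h1 : n * n < 2 ^ n.size * 2 ^ n.size := Nat.mul_self_lt_mul_self n.lt_size_self
  calc 65536 * (n * n) < 2 ^ 16 * (2 ^ n.size * 2 ^ n.size) := by omega
    _ = 2 ^ (16 + (n.size + n.size)) := by rw [pow_add, pow_add]
    _ ≤ 2 ^ (10 * n.size) := Nat.pow_le_pow_right (by norm_num) (by omega)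

theorem sum_length_rangeMinTabs_le (hn : 2 ≤ n) (pos a : ℕ → ℕ) :
    ((rangeMinTabs n pos a).map List.length).sum ≤ 14 * n := by
  have h1 := two_pow_size_le (show 0 < n by omega)
  have h2 := size_mul_blocks_le n
  have h3 := blocks_le hn
  simp only [rangeMinTabs, List.map_cons, List.length_map, List.length_range, List.map_nil,
    List.sum_cons, List.sum_nil]
  omega

theorem lowBit_le (m : ℕ) : lowBit m ≤ m := by
  rcases Set.eq_empty_or_nonempty {t | m.testBit t = true} with h | h
  · simp [lowBit, h]
  · exact Nat.lt_two_pow_self.le.trans (Nat.ge_two_pow_of_testBit (Nat.sInf_mem h))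

theorem rangeMinTabs_entry_le (hn : 2 ≤ n) {pos a : ℕ → ℕ} (hpos : ∀ k < n, pos k ≤ n)
    (ha : ∀ k < n, a k ≤ n) {t : List ℕ} (ht : t ∈ rangeMinTabs n pos a) {v : ℕ} (hv : v ∈ t) :
    v ≤ 2 * n := by
  have h1 := two_pow_size_le (show 0 < n by omega)
  have h2 := size_mul_blocks_le n
  have h3 := blocks_le hn
  simp only [rangeMinTabs, List.mem_cons, List.not_mem_nil, or_false] at ht
  rcases ht with rfl | rfl | rfl | rfl | rfl | rfl | rfl | rfl | rfl | rfl | rfl <;>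
    obtain ⟨k, hk, rfl⟩ := List.mem_map.mp hv <;> rw [List.mem_range] at hk
  · have := hpos k hk; omega
  · have := Nat.div_le_self k n.size
    omega
  · exact (rangeMin_le _ _ _).trans (by omega)
  · exact (rangeMin_le _ _ _).trans (by omega)
  · refine le_trans (Nat.mul_le_mul_right _ ?_) h2
    rcases Nat.eq_zero_or_pos k with rfl | hk0
    · simp
    · exact (Nat.log_lt_of_lt_pow hk0.ne' ((hk.trans_le h3).trans n.lt_size_self)).le
  · exact (rangeMin_le _ _ _).trans (by omega)
  · exact (rangeMin_le _ _ _).trans (by omega)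
  · exact (Nat.ofBits_lt_two_pow _).le.trans h1
  · have := Nat.mod_le k n.size
    omega
  · have := lowBit_le k
    omega
  · have := ha k hk; omega

end Sizes

/-! ## Ranking the cuts -/

theorem exists_rank {m : ℕ} (f : Fin m → ℝ) :
    ∃ e : Equiv.Perm (Fin m), ∀ i j, e i ≤ e j → f i ≤ f j :=
  ⟨(Tuple.sort f).symm, fun i j h => by simpa using Tuple.monotone_sort f h⟩

/-- A tree of cuts for `G`, its leaves numbered by `pos`, together with the list of a Steiner
mincut and the cuts of the tree by increasing value; `a` gives the rank of each gap. -/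
structure RankedCuts {n : ℕ} (G : WGraph n) (S : Finset (Fin n)) (h : Finset (Fin n) → ℝ)
    (t : CutTree n) (C₀ : Finset (Fin n)) (ranked : List (Finset (Fin n))) (pos a : ℕ → ℕ) :
    Prop where
  generic : IsGenericCut h
  refines : ∀ A B, h A ≤ h B → G.cap A ≤ G.cap B
  optimal : t.Optimal h S
  nodup : t.leaves.Nodup
  univ : t.leaves.toFinset = Finset.univ
  mincut : G.IsSteinerMincut S C₀
  length : ranked.length = n
  zero : ranked[0]? = some C₀
  mem_iff : ∀ C, C ∈ ranked ↔ C ∈ C₀ :: t.cuts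
  rank_lt : ∀ k, 0 < k → k < n → a k < n
  rank_le : ∀ k, a k ≤ n
  pos_lt : ∀ x : Fin n, pos x < n
  pos_inj : ∀ x y : Fin n, x ≠ y → pos x ≠ pos y
  best : ∀ x y : Fin n, x ≠ y → ∀ k, min (pos x) (pos y) < k → k ≤ max (pos x) (pos y) →
    (∀ k', min (pos x) (pos y) < k' → k' ≤ max (pos x) (pos y) → a k ≤ a k') →
    ∃ C, ranked[a k]? = some C ∧ IsBest h S x y C

theorem exists_rankedCuts {n : ℕ} (G : WGraph n) (S : Finset (Fin n)) (hS : 2 ≤ S.card) :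
    ∃ h t C₀ ranked pos a, RankedCuts G S h t C₀ ranked pos a := by
  obtain ⟨C₀, hC₀⟩ := G.exists_isSteinerMincut S hS
  obtain ⟨ρ, hρ⟩ := Finset.card_pos.mp (show 0 < S.card by omega)
  obtain ⟨h, hgen, href⟩ := G.exists_isGenericCut ρ
  obtain ⟨t, huniv, hnd, hopt⟩ := CutTree.exists_optimal (h := h) hS Finset.univ ⟨ρ, by simp⟩
  have hlen : t.leaves.length = n := by
    rw [← List.toFinset_card_of_nodup hnd, huniv, Finset.card_univ, Fintype.card_fin]
  have hcl := t.length_cuts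
  obtain ⟨e, he⟩ := exists_rank fun i : Fin t.cuts.length => h t.cuts[i]
  let ranked := C₀ :: List.ofFn fun i : Fin t.cuts.length => t.cuts[e.symm i]
  let pos : ℕ → ℕ := fun k => if hk : k < n then t.leaves.idxOf ⟨k, hk⟩ else 0
  -- Gap k lies between leaves k - 1 and k and carries cut number k - 1. Ranks start at 1 because 0
  -- belongs to C₀; outside the gaps the value n is a harmless maximum.
  let a : ℕ → ℕ := fun k =>
    if hk : 0 < k ∧ k < n then (e ⟨k - 1, by omega⟩).val + 1 else n
  have hpos : ∀ x : Fin n, pos x = t.leaves.idxOf x := fun x => by simp [pos]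
  have hmem : ∀ x, x ∈ t.leaves := fun x => by rw [← List.mem_toFinset, huniv]; simp
  have hget : ∀ x : Fin n, t.leaves[pos x]? = some x := fun x => by
    rw [hpos]
    simp [hmem x]
  have hposlt : ∀ x : Fin n, pos x < n := fun x => by
    have := (List.getElem?_eq_some_iff.mp (hget x)).1
    omega
  have hinj : ∀ x y : Fin n, x ≠ y → pos x ≠ pos y := fun x y hxy hc => by
    have := hget x
    rw [hc, hget y] at this
    exact hxy (Option.some.inj this).symm
  have ha : ∀ k (hk : 0 < k ∧ k < n), a k = (e ⟨k - 1, by omega⟩).val + 1 := fun k hk => by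
    simp only [a]
    rw [dif_pos hk]
  have hbest : ∀ x y : Fin n, pos x < pos y → ∀ k, pos x < k → k ≤ pos y →
      (∀ k', pos x < k' → k' ≤ pos y → a k ≤ a k') →
      ∃ C, ranked[a k]? = some C ∧ IsBest h S x y C := by
    intro x y hxy k hk1 hk2 hmin
    have hy := hposlt y
    refine ⟨t.cuts[k - 1], ?_, hopt.isBest_of_min (k := k - 1) hgen (hget x) (hget y) (by omega) (by omega)
      (List.getElem?_eq_getElem (by omega)) ?_⟩
    · rw [ha k (by omega)]
      simp [ranked]
    · intro k' C' h1 h2 h3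
      obtain ⟨h4, rfl⟩ := List.getElem?_eq_some_iff.mp h3
      have h5 := hmin (k' + 1) (by omega) (by omega)
      rw [ha k (by omega), ha (k' + 1) (by omega)] at h5
      exact he ⟨k - 1, by omega⟩ ⟨k', h4⟩ (Fin.le_def.mpr (by simpa using h5))
  refine ⟨h, t, C₀, ranked, pos, a, hgen, href, hopt, hnd, huniv, hC₀, by simp [ranked]; omega, rfl,
    fun C => ?_, fun k h1 h2 => ?_, fun k => ?_, hposlt, hinj, fun x y hxy k h1 h2 hmin => ?_⟩
  · simp only [ranked, List.mem_cons, List.mem_ofFn, List.mem_iff_getElem (l := t.cuts)]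
    refine or_congr Iff.rfl ⟨?_, ?_⟩
    · rintro ⟨i, hi⟩
      exact ⟨(e.symm i).val, (e.symm i).2, hi⟩
    · rintro ⟨i, hi, hC⟩
      exact ⟨e ⟨i, hi⟩, by simpa using hC⟩
  · rw [ha k ⟨h1, h2⟩]
    omega
  · by_cases hk : 0 < k ∧ k < n
    · rw [ha k hk]
      omega
    · simp only [a]
      rw [dif_neg hk]
  · rcases lt_or_gt_of_ne (hinj x y hxy) with hlt | hlt
    · rw [min_eq_left hlt.le, max_eq_right hlt.le] at *
      exact hbest x y hlt k h1 h2 hmin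
    · rw [min_eq_right hlt.le, max_eq_left hlt.le] at *
      obtain ⟨C, hC, hb⟩ := hbest y x hlt k h1 h2 hmin
      exact ⟨C, hC, hb.symm⟩

/-! ## The data structures -/

section Assembly

variable {n : ℕ} {G : WGraph n} {S : Finset (Fin n)} {h : Finset (Fin n) → ℝ} {t : CutTree n}
  {C₀ : Finset (Fin n)} {ranked : List (Finset (Fin n))} {pos a : ℕ → ℕ}

theorem WGraph.IsSteinerMincut.compl {C : Finset (Fin n)} (hC : G.IsSteinerMincut S C) :
    G.IsSteinerMincut S Cᶜ :=
  ⟨isSteinerCut_compl.mpr hC.1, fun D hD => by rw [G.cap_compl]; exact hC.2 D hD⟩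

theorem RankedCuts.length_leaves (R : RankedCuts G S h t C₀ ranked pos a) :
    t.leaves.length = n := by
  rw [← List.toFinset_card_of_nodup R.nodup, R.univ, Finset.card_univ, Fintype.card_fin]

theorem RankedCuts.posFn_le (R : RankedCuts G S h t C₀ ranked pos a) (k : ℕ) (hk : k < n) :
    pos k ≤ n := (R.pos_lt ⟨k, hk⟩).le

/-- The tables storing the capacity tree and the query structure. -/
noncomputable def capTabs (G : WGraph n) (t : CutTree n) (ranked : List (Finset (Fin n)))
    (pos a : ℕ → ℕ) : List (List ℕ) :=
  (t.toCap G).encode (ranked.map G.cap).idxOf 13 ::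
    List.ofFn (fun u => (t.toCap G).leafAddr (ranked.map G.cap).idxOf 13 u) ::
    (rangeMinTabs n pos a ++ [])

theorem RankedCuts.capTabs_length (R : RankedCuts G S h t C₀ ranked pos a) (hn : 2 ≤ n) :
    (packTables (capTabs G t ranked pos a)).length ≤ 30 * n := by
  have h1 := (t.toCap G).length_encode_le (ranked.map G.cap).idxOf 13
  have h2 := t.toCap_numNodes G
  have h3 := R.length_leaves
  have h4 := sum_length_rangeMinTabs_le hn pos a
  rw [length_packTables]
  simp only [capTabs, List.append_nil, List.length_cons, List.map_cons, List.sum_cons,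
    List.length_ofFn]
  have h5 : (rangeMinTabs n pos a).length = 11 := rfl
  omega

theorem RankedCuts.capTabs_entry_lt (R : RankedCuts G S h t C₀ ranked pos a) (hn : 2 ≤ n) {v : ℕ}
    (hv : v ∈ packTables (capTabs G t ranked pos a)) : v < 2 ^ (10 * n.size) := by
  have hlen := R.capTabs_length hn
  have hb := word_size_bound hn
  have hnn : n ≤ n * n := Nat.le_mul_self n
  suffices v ≤ 40 * n by omega
  have hrec := (t.toCap G).length_encode_le (ranked.map G.cap).idxOf 13
  have hnum := t.toCap_numNodes G
  have hlv := R.length_leaves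
  rcases mem_packTables hv with hv | ⟨s, hs, hv⟩
  · omega
  · simp only [capTabs, List.append_nil, List.mem_cons] at hs
    rcases hs with rfl | rfl | hs
    · refine CapTree.encode_entry_le (by omega) (fun c _ => ?_) hv
      have := List.idxOf_le_length (a := c) (l := ranked.map G.cap)
      rw [List.length_map, R.length] at this
      omega
    · obtain ⟨u, rfl⟩ := (List.mem_ofFn' _ _).mp hv
      exact ((t.toCap G).leafAddr_le (ranked.map G.cap).idxOf 13 u).trans (by omega)
    · have := rangeMinTabs_entry_le hn R.posFn_le (fun k _ => R.rank_le k) hs hv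
      omega

theorem RankedCuts.capTabs_storedIn (R : RankedCuts G S h t C₀ ranked pos a) :
    (t.toCap G).StoredIn ⟨packTables (capTabs G t ranked pos a), ranked.map G.cap⟩ := by
  -- There are 2 + 11 tables, so the first one starts right after 13 pointers. The first two
  -- pointers double as the root and leaf-array pointers that `StoredIn` demands.
  have hb0 : tableBase (capTabs G t ranked pos a) 0 = 13 := rfl
  have hlt : 1 < (capTabs G t ranked pos a).length := by simp [capTabs]
  refine ⟨13, tableBase (capTabs G t ranked pos a) 1, ?_, packTables_pointer hlt,
    CapTree.storedAt_of_encode (idx := (ranked.map G.cap).idxOf) (t.toCap_disjointLeaves G R.nodup)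
      (fun k v hk => ?_) (fun u _ => ?_) (fun c hc => ?_)⟩
  · rw [← hb0]
    exact packTables_pointer (by omega)
  · rw [← hb0]
    exact packTables_entry rfl hk
  · exact packTables_entry rfl (by simp)
  · rw [CutTree.toCap_caps] at hc
    obtain ⟨C, hC, rfl⟩ := List.mem_map.mp hc
    have hmem : G.cap C ∈ ranked.map G.cap :=
      List.mem_map_of_mem ((R.mem_iff C).mpr (List.mem_cons_of_mem _ hC))
    simp [hmem]

/-- The tables storing the cuts and the query structure. -/
noncomputable def cutTabs (fst lst : ℕ → ℕ) (mem : List (Fin n)) (pos a : ℕ → ℕ) :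
    List (List ℕ) :=
  (List.range n).map fst :: (List.range n).map lst ::
    (rangeMinTabs n pos a ++ [(List.range mem.length).map fun k => (mem.map Fin.val).getD k 0])

theorem cutTabs_length (hn : 2 ≤ n) (fst lst : ℕ → ℕ) (mem : List (Fin n)) (pos a : ℕ → ℕ) :
    (packTables (cutTabs fst lst mem pos a)).length ≤ 23 * n + mem.length := by
  have h4 := sum_length_rangeMinTabs_le hn pos a
  rw [length_packTables]
  simp only [cutTabs, List.length_cons, List.map_cons, List.sum_cons, List.length_append,
    List.map_append, List.sum_append, List.length_map, List.length_range, List.map_nil,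
    List.sum_nil, List.length_nil]
  have h5 : (rangeMinTabs n pos a).length = 11 := rfl
  omega

theorem cutTabs_entry_le (hn : 2 ≤ n) {fst lst : ℕ → ℕ} {mem : List (Fin n)} {pos a : ℕ → ℕ}
    (hpos : ∀ k < n, pos k ≤ n) (ha : ∀ k < n, a k ≤ n) (hfst : ∀ k < n, fst k ≤ mem.length)
    (hlst : ∀ k < n, lst k ≤ mem.length) {v : ℕ}
    (hv : v ∈ packTables (cutTabs fst lst mem pos a)) : v ≤ 23 * n + mem.length := by
  rcases mem_packTables hv with hv | ⟨s, hs, hv⟩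
  · exact hv.trans (cutTabs_length hn ..)
  · simp only [cutTabs, List.mem_cons, List.mem_append, List.not_mem_nil, or_false] at hs
    rcases hs with rfl | rfl | hs | rfl
    · obtain ⟨k, hk, rfl⟩ := List.mem_map.mp hv
      exact (hfst k (List.mem_range.mp hk)).trans (by omega)
    · obtain ⟨k, hk, rfl⟩ := List.mem_map.mp hv
      exact (hlst k (List.mem_range.mp hk)).trans (by omega)
    · have := rangeMinTabs_entry_le hn hpos ha hs hv
      omega
    · obtain ⟨k, hk, rfl⟩ := List.mem_map.mp hv
      rw [List.mem_range] at hk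
      have : ((mem.map Fin.val).getD k 0) < n := by simp [hk]
      omega

/-- Every ranked cut is listed, up to complement, by a segment of the store. -/
theorem RankedCuts.exists_segments (R : RankedCuts G S h t C₀ ranked pos a) {mem : List (Fin n)}
    (hmem : ∀ C ∈ C₀ :: t.cuts, ∃ l, l <:+: mem ∧ l.Nodup ∧ (l.toFinset = C ∨ l.toFinset = Cᶜ)) :
    ∃ (fst : ℕ → ℕ) (seg : ℕ → List (Fin n)), ∀ m < n, fst m + (seg m).length ≤ mem.length ∧
      (∀ q v, (seg m)[q]? = some v → mem[fst m + q]? = some v) ∧ (seg m).Nodup ∧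
      ∀ C, ranked[m]? = some C → (seg m).toFinset = C ∨ (seg m).toFinset = Cᶜ := by
  have : ∀ m, ∃ (s : ℕ) (l : List (Fin n)), m < n → s + l.length ≤ mem.length ∧
      (∀ q v, l[q]? = some v → mem[s + q]? = some v) ∧ l.Nodup ∧
      ∀ C, ranked[m]? = some C → l.toFinset = C ∨ l.toFinset = Cᶜ := by
    intro m
    by_cases hm : m < n
    · have hm' : m < ranked.length := by rw [R.length]; exact hm
      obtain ⟨l, ⟨p, q, rfl⟩, hnd, hl⟩ := hmem ranked[m] ((R.mem_iff _).mp (List.getElem_mem hm'))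
      refine ⟨p.length, l, fun _ => ⟨by simp, fun k v hk => ?_, hnd, fun C hC => ?_⟩⟩
      · rw [List.append_assoc, List.getElem?_append_right (by omega), Nat.add_sub_cancel_left,
          List.getElem?_append_left (List.getElem?_eq_some_iff.mp hk).1, hk]
      · rw [List.getElem?_eq_getElem hm', Option.some.injEq] at hC
        rwa [← hC]
    · exact ⟨0, [], fun h => absurd h hm⟩
  choose fst seg h using this
  exact ⟨fst, seg, h⟩

end Assembly

theorem exists_capStructure (n : ℕ) (G : WGraph n) (S : Finset (Fin n)) (hS : 2 ≤ S.card) :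
    ∃ (T : CapTree n) (D : DataStruct),
      T.verts = Finset.univ ∧ T.DisjointLeaves ∧ T.numNodes ≤ 100 * n ∧
      T.StoredIn D ∧ D.ValidFor G (10 * n.size) ∧ D.space ≤ 100 * n ∧
      ∀ x y : Fin n, G.graph.Adj x y →
        ∃ μ : ℝ, T.lcaCap x y = some μ ∧
          ∀ (Δ : ℝ) (_ : 0 ≤ Δ) (hΔ : Δ ≤ G.w s(x, y)),
            (G.reduce s(x, y) Δ hΔ).steinerCap S = min (G.steinerCap S) (μ - Δ) ∧
            Answers capProg D (10 * n.size) x y Δ 100 []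
              [(G.reduce s(x, y) Δ hΔ).steinerCap S] := by
  have hn : 2 ≤ n := hS.trans (by simpa using S.card_le_univ)
  obtain ⟨h, t, C₀, ranked, pos, a, R⟩ := exists_rankedCuts G S hS
  have hlen := R.capTabs_length hn
  have hb := word_size_bound hn
  have hnn : 2 * n ≤ n * n := Nat.mul_le_mul_right n hn
  have hnum := t.toCap_numNodes G
  have hlv := R.length_leaves
  have hD : RangeMinTables ⟨packTables (capTabs G t ranked pos a), ranked.map G.cap⟩
      (10 * n.size) n pos a :=
    rangeMinTables_of_packTables (by change (packTables (capTabs G t ranked pos a)).length ≤ _; omega)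
  refine ⟨t.toCap G, ⟨packTables (capTabs G t ranked pos a), ranked.map G.cap⟩,
    by rw [t.toCap_verts, R.univ], t.toCap_disjointLeaves G R.nodup, by omega, R.capTabs_storedIn,
    ⟨fun v hv => R.capTabs_entry_lt hn hv, fun r hr => ?_⟩, ?_, fun x y hxy => ?_⟩
  · obtain ⟨C, -, rfl⟩ := List.mem_map.mp hr
    exact ⟨C, rfl⟩
  · simp only [DataStruct.space, List.length_map, R.length]
    omega
  · have hmem : ∀ z, z ∈ t.leaves := fun z => by rw [← List.mem_toFinset, R.univ]; simp
    obtain ⟨C, hC, hlca⟩ := R.optimal.exists_lcaCap G (hmem x) (hmem y) hxy.ne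
    refine ⟨G.cap C, hlca, fun Δ h0 hΔ => ?_⟩
    have hval := G.reduce_steinerCap R.refines hxy hC R.mincut h0 hΔ
    refine ⟨by rw [hval, R.mincut.cap_eq], ?_⟩
    obtain ⟨k, hk1, hk2, hmin, hans⟩ := capProg_answers hD (by omega) R.rank_lt x y
      (R.pos_inj x y hxy.ne) (R.pos_lt x) (R.pos_lt y) Δ (lam := G.cap C₀) (by simp [R.zero])
    obtain ⟨C', hC', hbest⟩ := R.best x y hxy.ne k hk1 hk2 hmin
    -- The cut found by range minimum need not be the one at the common ancestor, but both are best
    -- for x and y.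
    have hcap : G.cap C' = G.cap C := le_antisymm
      (R.refines _ _ (hbest.le C hC.steiner hC.sep)) (R.refines _ _ (hC.le C' hbest.steiner hbest.sep))
    rw [hval]
    exact hans (G.cap C) (by simp [hC', hcap])

theorem exists_cutStructure (n : ℕ) (G : WGraph n) (S : Finset (Fin n)) (hS : 2 ≤ S.card) :
    ∃ D : DataStruct,
      D.ValidFor G (10 * n.size) ∧ D.space ≤ 130 * (n * (n - S.card + 1)) ∧
      ∀ x y : Fin n, G.graph.Adj x y →
        ∀ (Δ : ℝ) (_ : 0 ≤ Δ) (hΔ : Δ ≤ G.w s(x, y)),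
          ∃ l : List (Fin n), l.Nodup ∧
            (G.reduce s(x, y) Δ hΔ).IsSteinerMincut S l.toFinset ∧
            Answers cutProg D (10 * n.size) x y Δ (130 * l.toFinset.card) (l.map Fin.val) [] := by
  have hSn : S.card ≤ n := by simpa using S.card_le_univ
  have hn : 2 ≤ n := hS.trans hSn
  obtain ⟨h, t, C₀, ranked, pos, a, R⟩ := exists_rankedCuts G S hS
  obtain ⟨mem, hmlen, hmem⟩ := R.optimal.exists_store R.generic R.nodup R.univ ⟨0, by omega⟩ C₀
  obtain ⟨fst, seg, hseg⟩ := R.exists_segments hmem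
  have hlen := cutTabs_length hn fst (fun m => fst m + (seg m).length) mem pos a
  have hb := word_size_bound hn
  have hnn : 2 * n ≤ n * n := Nat.mul_le_mul_right n hn
  have hX1 : n ≤ n * (n - S.card + 1) := Nat.le_mul_of_pos_right n (by omega)
  have hX2 : n * (n - S.card + 1) ≤ n * n := Nat.mul_le_mul_left n (by omega)
  have hD : RangeMinTables ⟨packTables (cutTabs fst (fun m => fst m + (seg m).length) mem pos a),
      ranked.map G.cap⟩ (10 * n.size) n pos a :=
    rangeMinTables_of_packTables (by
      change (packTables (cutTabs fst (fun m => fst m + (seg m).length) mem pos a)).length ≤ _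
      omega)
  refine ⟨⟨packTables (cutTabs fst (fun m => fst m + (seg m).length) mem pos a),
    ranked.map G.cap⟩, ⟨fun v hv => ?_, fun r hr => ?_⟩, ?_, fun x y hxy Δ h0 hΔ => ?_⟩
  · have := cutTabs_entry_le hn R.posFn_le (fun k _ => R.rank_le k)
      (fun k hk => (Nat.le_add_right _ _).trans (hseg k hk).1) (fun k hk => (hseg k hk).1) hv
    omega
  · obtain ⟨C, -, rfl⟩ := List.mem_map.mp hr
    exact ⟨C, rfl⟩
  · simp only [DataStruct.space, List.length_map, R.length]
    omega
  · obtain ⟨k, hk1, hk2, hmin, hans⟩ := cutProg_answers hD (by omega) R.rank_lt x y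
      (R.pos_inj x y hxy.ne) (R.pos_lt x) (R.pos_lt y) Δ (lam := G.cap C₀) (by simp [R.zero])
      (.of_packTables rfl (by omega)) (.of_packTables rfl (by omega)) (.of_packTables rfl (by omega))
      (by omega)
    obtain ⟨C, hC, hbest⟩ := R.best x y hxy.ne k hk1 hk2 hmin
    have hkn : a k < n := R.rank_lt k (by omega) (by have := R.pos_lt x; have := R.pos_lt y; omega)
    obtain ⟨m, hm⟩ : ∃ m, m = if G.cap C - Δ < G.cap C₀ then a k else 0 := ⟨_, rfl⟩
    have hmn : m < n := by split_ifs at hm <;> omega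
    have hcut : ∃ C', ranked[m]? = some C' ∧ (G.reduce s(x, y) Δ hΔ).IsSteinerMincut S C' := by
      split_ifs at hm with hlt
      · exact ⟨C, by rw [hm, hC], G.reduce_best_isSteinerMincut R.refines hxy hbest R.mincut hΔ hlt.le⟩
      · exact ⟨C₀, by rw [hm, R.zero],
          (G.reduce_min_isSteinerMincut R.refines hxy hbest R.mincut h0 hΔ (not_lt.mp hlt)).1⟩
    obtain ⟨C', hC', hmc⟩ := hcut
    obtain ⟨s1, s2, s3, s4⟩ := hseg m hmn
    have hmc' : (G.reduce s(x, y) Δ hΔ).IsSteinerMincut S (seg m).toFinset := by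
      rcases s4 C' hC' with e | e <;> rw [e]
      · exact hmc
      · exact hmc.compl
    refine ⟨seg m, s3, hmc', ?_⟩
    have hA := hans (G.cap C) (by simp [hC]) ((seg m).map Fin.val) m hm (by simp) s1
      (fun q v hq => ?_)
    · obtain ⟨t, ht, hrest⟩ := hA
      refine ⟨t, ht.trans ?_, hrest⟩
      -- A Steiner cut is nonempty, so the constant overhead 120 is absorbed into 130 times its
      -- size.
      obtain ⟨s, -, s', -, hs, -⟩ := hmc'.1
      have hpos := Finset.card_pos.mpr ⟨s, hs⟩
      rw [List.toFinset_card_of_nodup s3] at hpos ⊢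
      rw [List.length_map]
      omega
    · rw [List.getElem?_map, Option.map_eq_some_iff] at hq
      obtain ⟨u, hu, rfl⟩ := hq
      simp [s2 q u hu]

theorem mainTheorem1 :
    (∃ (P : List Instr) (κ c : ℕ),
      ∀ (n : ℕ) (G : WGraph n) (S : Finset (Fin n)), 2 ≤ S.card →
        ∃ (T : CapTree n) (D : DataStruct),
          T.verts = Finset.univ ∧ T.DisjointLeaves ∧ T.numNodes ≤ c * n ∧
          T.StoredIn D ∧ D.ValidFor G (κ * n.size) ∧ D.space ≤ c * n ∧
          ∀ x y : Fin n, G.graph.Adj x y →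
            ∃ μ : ℝ, T.lcaCap x y = some μ ∧
              ∀ (Δ : ℝ) (_ : 0 ≤ Δ) (hΔ : Δ ≤ G.w s(x, y)),
                (G.reduce s(x, y) Δ hΔ).steinerCap S = min (G.steinerCap S) (μ - Δ) ∧
                Answers P D (κ * n.size) x y Δ c []
                  [(G.reduce s(x, y) Δ hΔ).steinerCap S]) ∧
    (∃ (P : List Instr) (κ c : ℕ),
      ∀ (n : ℕ) (G : WGraph n) (S : Finset (Fin n)), 2 ≤ S.card →
        ∃ D : DataStruct,
          D.ValidFor G (κ * n.size) ∧ D.space ≤ c * (n * (n - S.card + 1)) ∧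
          ∀ x y : Fin n, G.graph.Adj x y →
            ∀ (Δ : ℝ) (_ : 0 ≤ Δ) (hΔ : Δ ≤ G.w s(x, y)),
              ∃ l : List (Fin n), l.Nodup ∧
                (G.reduce s(x, y) Δ hΔ).IsSteinerMincut S l.toFinset ∧
                Answers P D (κ * n.size) x y Δ (c * l.toFinset.card)
                  (l.map Fin.val) []) :=
  ⟨⟨capProg, 10, 100, exists_capStructure⟩, ⟨cutProg, 10, 130, exists_cutStructure⟩⟩
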